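/- Let $d\in\mathbb N$ and $S=\mathbb R^d\setminus\{0\}$, with Euclidean norm $\|\cdot\|$. For $c>0$ let $\eta_c$ denote the Poisson process on $(0,\infty)$ with intensity measure $c\,t^{-1}\,dt$. For a random vector $V$ in $S$, write $\eta_c=\sum_{k\ge1}X_k\delta_{Z_k}$ with random $X_k\in\{0,1,2,\dots\}$ and $Z_k\in(0,\infty)$, let $(V_k)_{k\ge1}$ be i.i.d. copies of $V$ such that the sequence $(V_k)_{k\ge1}$ is independent of $(X_k,Z_k)_{k\ge1}$, and let $$\eta_c^V=\sum_{k\ge1}X_k\,\delta_{V_kZ_k}$$ be the uplifted process. A Poisson process on $S$ has a locally finite intensity measure. A random measure $\nu$ on $S$ is scale-invariant if, for every $t>0$, the random measure $A\mapsto\nu(t^{-1}A)$ has the same distribution as $\nu$. (1) Every scale-invariant Poisson process on $S$ that is not almost surely the zero measure has the same distribution as $\eta_c^U$ for some $c>0$ and some random vector $U$ in $\mathbb R^d$ with $\|U\|=1$. (2) Let $c>0$ and let $V$ be a random vector in $S$ such that $\mathbb E\sum_{k\ge1}X_k\mathbf 1\{Z_k\|V_k\|\in[a,b]\}<\infty$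 for all $0<a<b<\infty$. Then $\eta_c^V$ has the same distribution as $\eta_c^U$ with $U=V/\|V\|$. -/

import Mathlib

open MeasureTheory ProbabilityTheory
open scoped ENNReal NNReal

/-- The punctured Euclidean space `ℝ^d ∖ {0}`, with its subspace topology, its Borel
`σ`-algebra, and the Euclidean norm `‖(x : EuclideanSpace ℝ (Fin d))‖`. -/
abbrev PuncturedSpace (d : ℕ) : Type := {x : EuclideanSpace ℝ (Fin d) // x ≠ 0}

/-- The open half-line `(0, ∞)`. -/
abbrev HalfLine : Type := {t : ℝ // 0 < t}

/-- The vector `t x`, for `t > 0` and `x ≠ 0`. -/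
def scaleVec {d : ℕ} (t : HalfLine) (x : PuncturedSpace d) : PuncturedSpace d :=
  ⟨t.1 • x.1, smul_ne_zero t.2.ne' x.2⟩

/-- The unit vector `x / ‖x‖`, for `x ≠ 0`. -/
noncomputable def direction {d : ℕ} (x : PuncturedSpace d) : PuncturedSpace d :=
  ⟨‖x.1‖⁻¹ • x.1, smul_ne_zero (inv_ne_zero (norm_ne_zero_iff.2 x.2)) x.2⟩

/-- The scaling `T_t μ` of a measure: `(T_t μ)(A) = μ (t⁻¹ A)`, that is, the push-forward of `μ`
under `x ↦ t x`. -/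
noncomputable def scaleMeasure {d : ℕ} (t : HalfLine) (μ : Measure (PuncturedSpace d)) :
    Measure (PuncturedSpace d) :=
  μ.map (scaleVec t)

/-- `ξ` is a point process on `E`: a random locally finite measure taking values in
`{0, 1, 2, …}` on relatively compact Borel sets. The space of measures carries the `σ`-algebra
generated by the evaluations `μ ↦ μ A` at Borel sets `A`. -/
structure IsPointProcess {Ω E : Type*} [MeasurableSpace Ω] [TopologicalSpace E]
    [MeasurableSpace E] (P : Measure Ω) (ξ : Ω → Measure E) : Prop where
  measurable : Measurable ξ
  locallyFinite : ∀ᵐ ω ∂P, IsLocallyFiniteMeasure (ξ ω)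
  counting : ∀ᵐ ω ∂P, ∀ A : Set E, MeasurableSet A → (∃ K, IsCompact K ∧ A ⊆ K) →
    ∃ n : ℕ, ξ ω A = n

/-- `ξ` is a Poisson process on `E` with locally finite intensity measure `Λ`: a point process
with `ξ B` Poisson distributed with mean `Λ B` when `Λ B < ∞`, and with `ξ B₁, …, ξ Bₙ`
independent for pairwise disjoint Borel sets `B₁, …, Bₙ`. -/
structure IsPoissonProcess {Ω E : Type*} [MeasurableSpace Ω] [TopologicalSpace E]
    [MeasurableSpace E] (P : Measure Ω) (ξ : Ω → Measure E) (Λ : Measure E) : Prop where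
  isPointProcess : IsPointProcess P ξ
  intensity_locallyFinite : IsLocallyFiniteMeasure Λ
  law : ∀ B : Set E, MeasurableSet B → Λ B ≠ ∞ →
    P.map (fun ω => ξ ω B) = (poissonMeasure (Λ B).toNNReal).map (fun n : ℕ => (n : ℝ≥0∞))
  indep : ∀ (n : ℕ) (B : Fin n → Set E), (∀ i, MeasurableSet (B i)) →
    Pairwise (fun i j => Disjoint (B i) (B j)) → iIndepFun (fun i ω => ξ ω (B i)) P

/-- The random measure `ν` is scale-invariant: `T_t ν` has the same law as `ν` for all `t > 0`. -/
def IsScaleInvariant {Ω : Type*} [MeasurableSpace Ω] {d : ℕ} (P : Measure Ω)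
    (ν : Ω → Measure (PuncturedSpace d)) : Prop :=
  ∀ t : HalfLine, IdentDistrib (fun ω => scaleMeasure t (ν ω)) ν P P

/-- The measure `c t⁻¹ dt` on `(0, ∞)`. -/
noncomputable def etaIntensity (c : ℝ) : Measure HalfLine :=
  ((volume : Measure ℝ).comap Subtype.val).withDensity fun t => ENNReal.ofReal (c * t.1⁻¹)

/-- The random measure `∑ₖ Xₖ δ_{Yₖ}`. -/
noncomputable def pointSum {Ω E : Type*} [MeasurableSpace E] (X : ℕ → Ω → ℕ) (Y : ℕ → Ω → E)
    (ω : Ω) : Measure E :=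
  Measure.sum fun k => (X k ω : ℝ≥0∞) • Measure.dirac (Y k ω)

/-- The process `∑ₖ Xₖ δ_{Vₖ Zₖ}`, that is, `ξ` uplifted by the vectors `Vₖ`, where
`ξ = ∑ₖ Xₖ δ_{Zₖ}`. -/
noncomputable def uplift {Ω : Type*} {d : ℕ} (X : ℕ → Ω → ℕ) (Z : ℕ → Ω → HalfLine)
    (V : ℕ → Ω → PuncturedSpace d) : Ω → Measure (PuncturedSpace d) :=
  pointSum X fun k ω => scaleVec (Z k ω) (V k ω)

/-- The data behind the uplifted process `η_c^{V₀}`: a Poisson process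
`η_c = ∑ₖ Xₖ δ_{Zₖ}` on `(0, ∞)` with intensity `c t⁻¹ dt`, and i.i.d. copies `Vₖ` of the random
vector `V₀` that are independent of it. The process itself is then `uplift X Z V`. -/
structure IsEtaUplift {Ω Ω₀ : Type*} [MeasurableSpace Ω] [MeasurableSpace Ω₀] {d : ℕ}
    (c : ℝ) (P₀ : Measure Ω₀) (V₀ : Ω₀ → PuncturedSpace d) (P : Measure Ω)
    (X : ℕ → Ω → ℕ) (Z : ℕ → Ω → HalfLine) (V : ℕ → Ω → PuncturedSpace d) : Prop where
  measurable_mult : ∀ k, Measurable (X k)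
  measurable_point : ∀ k, Measurable (Z k)
  measurable_vec : ∀ k, Measurable (V k)
  isPoisson : IsPoissonProcess P (pointSum X Z) (etaIntensity c)
  identDistrib : ∀ k, IdentDistrib (V k) V₀ P P₀
  iIndep : iIndepFun V P
  indep : IndepFun (fun ω k => (X k ω, Z k ω)) (fun ω k => V k ω) P

/-- Admissibility of the uplifting:
`𝔼 ∑ₖ Xₖ 1{Zₖ ‖Vₖ‖ ∈ [a, b]} < ∞` for all `0 < a < b < ∞`. -/
def IsAdmissible {Ω : Type*} [MeasurableSpace Ω] {d : ℕ} (P : Measure Ω)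
    (X : ℕ → Ω → ℕ) (Z : ℕ → Ω → HalfLine) (V : ℕ → Ω → PuncturedSpace d) : Prop :=
  ∀ a b : ℝ, 0 < a → a < b →
    ∫⁻ ω, ∑' k, (X k ω : ℝ≥0∞) *
      (Set.Icc a b).indicator 1 ((Z k ω).1 * ‖(V k ω).1‖) ∂P < ∞

/-! The proof compares Laplace functionals `f ↦ 𝔼 exp (-∫ f dξ)`, with `f` running over all
measurable functions into `[0, ∞]`. They determine the law of a random measure
(`identDistrib_of_laplace_eq`): linear combinations of indicators give the joint Laplace transforms
of finitely many evaluations, and Stone–Weierstrass on the compact cube `[0, ∞]^n` recovers the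
joint laws. For a Poisson process with intensity `Λ` the functional is `exp (-∫ (1 - e^{-f}) dΛ)`
(`IsPoissonProcess.laplace_eq`).

The points of `η_c` are almost surely simple, so integrating out the independent marks turns the
uplift by `V` into `η_c` tested against `z ↦ -log 𝔼 e^{-f(zV)}` (`laplace_uplift`). Hence the uplift
has the Laplace functional of a Poisson process with intensity `𝔼 ∫ δ_{zV} c z⁻¹ dz`. Since `z⁻¹ dz`
is invariant under `z ↦ z‖V‖`, this intensity depends on `V` only through `V/‖V‖`
(`lintegral_scaleVec_direction`), which is the second claim.

For the first claim, `Λ` is determined by the Laplace functional, so it inherits scale invariance.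
Every `y ≠ 0` lies in the shell `z < ‖y‖ ≤ ez` for a set of `z` of `z⁻¹ dz`-measure one. Inserting
this weight and using Fubini and invariance writes `Λ` as a mixture of the ray measures `∫ δ_{zx}
z⁻¹ dz` over `x` in the shell `1 < ‖x‖ ≤ e` (`lintegral_unitShell_rays`). So `c` is the `Λ`-mass of
that shell, and `U` is the direction of a point drawn from the normalized restriction of `Λ` to it.
A realization of the uplift is built from independent cells (`exists_isEtaUplift`). -/

/-! ### The exponential on `[0, ∞]` -/

/-- The decreasing bijection `x ↦ exp (-x)` from `[0, ∞]` to `[0, 1]`. -/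
noncomputable def expNeg (x : ℝ≥0∞) : ℝ≥0∞ := EReal.exp (-(x : EReal))

theorem expNeg_zero : expNeg 0 = 1 := by simp [expNeg]

theorem expNeg_coe (x : ℝ≥0) : expNeg x = ENNReal.ofReal (Real.exp (-x)) := by
  rw [expNeg, ← EReal.exp_coe]; rfl

theorem expNeg_le_one (x : ℝ≥0∞) : expNeg x ≤ 1 := by
  simp [expNeg, EReal.coe_ennreal_nonneg x]

theorem expNeg_ne_top (x : ℝ≥0∞) : expNeg x ≠ ∞ := ne_top_of_le_ne_top (by simp) (expNeg_le_one x)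

theorem expNeg_add (x y : ℝ≥0∞) : expNeg (x + y) = expNeg x * expNeg y := by
  rw [expNeg, EReal.coe_ennreal_add, EReal.neg_add (by simp) (by simp), sub_eq_add_neg,
    EReal.exp_add]
  rfl

theorem expNeg_sum {ι : Type*} (s : Finset ι) (f : ι → ℝ≥0∞) :
    expNeg (∑ i ∈ s, f i) = ∏ i ∈ s, expNeg (f i) := by
  classical
  induction s using Finset.induction_on with
  | empty => simp [expNeg_zero]
  | insert a s ha ih => rw [Finset.sum_insert ha, Finset.prod_insert ha, expNeg_add, ih]

theorem expNeg_nat_mul (n : ℕ) (x : ℝ≥0∞) : expNeg (n * x) = expNeg x ^ n := by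
  have h := expNeg_sum (Finset.range n) fun _ => x
  simpa using h

theorem continuous_expNeg : Continuous expNeg :=
  ENNReal.continuous_exp.comp (continuous_neg.comp continuous_coe_ennreal_ereal)

theorem measurable_expNeg : Measurable expNeg := continuous_expNeg.measurable

@[fun_prop]
theorem Measurable.expNeg {α : Type*} {_ : MeasurableSpace α} {f : α → ℝ≥0∞} (hf : Measurable f) :
    Measurable fun x => expNeg (f x) := measurable_expNeg.comp hf

theorem expNeg_strictAnti : StrictAnti expNeg := fun _ _ h =>
  EReal.exp_strictMono (EReal.neg_lt_neg_iff.2 (EReal.coe_ennreal_lt_coe_ennreal_iff.2 h))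

theorem expNeg_injective : Function.Injective expNeg := expNeg_strictAnti.injective

theorem one_sub_expNeg_le (x : ℝ≥0∞) : 1 - expNeg x ≤ 1 := tsub_le_self

theorem one_sub_expNeg_mono {x y : ℝ≥0∞} (h : x ≤ y) : 1 - expNeg x ≤ 1 - expNeg y :=
  tsub_le_tsub_left (expNeg_strictAnti.antitone h) 1

theorem continuous_one_sub_expNeg : Continuous fun x => 1 - expNeg x :=
  (ENNReal.continuous_sub_left (by simp)).comp continuous_expNeg

/-- The inverse `q ↦ -log q` of `expNeg` on `[0, 1]`. -/
noncomputable def negLog (q : ℝ≥0∞) : ℝ≥0∞ := (-(ENNReal.log q)).toENNReal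

theorem expNeg_negLog {q : ℝ≥0∞} (hq : q ≤ 1) : expNeg (negLog q) = q := by
  have h : 0 ≤ -(ENNReal.log q) := by
    rw [EReal.neg_nonneg]; simpa using hq
  rw [expNeg, negLog, EReal.coe_toENNReal h, neg_neg, ENNReal.exp_log]

theorem measurable_negLog : Measurable negLog :=
  (ENNReal.measurable_log.neg).ereal_toENNReal

/-! ### Laplace transforms on `[0, ∞]^ι` -/

theorem lintegral_poissonMeasure_pow (r : ℝ≥0) {q : ℝ≥0∞} (hq : q ≤ 1) :
    ∫⁻ n : ℕ, q ^ n ∂poissonMeasure r = expNeg (r * (1 - q)) := by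
  lift q to ℝ≥0 using ne_top_of_le_ne_top (by simp) hq
  have hq1 : q ≤ 1 := by exact_mod_cast hq
  have h1 : (r : ℝ≥0∞) * (1 - (q : ℝ≥0∞)) = ((r * (1 - q) : ℝ≥0) : ℝ≥0∞) := by push_cast; rfl
  rw [h1, expNeg_coe, poissonMeasure, lintegral_sum_measure]
  simp only [lintegral_smul_measure, lintegral_dirac, smul_eq_mul]
  have h2 : ∀ n : ℕ, ENNReal.ofReal (Real.exp (-r) * r ^ n / (n.factorial)) * (q : ℝ≥0∞) ^ n
      = ENNReal.ofReal (Real.exp (-r) * ((r * q : ℝ) ^ n / (n.factorial))) := by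
    intro n
    rw [← ENNReal.coe_pow, ← ENNReal.ofReal_coe_nnreal, ← ENNReal.ofReal_mul (by positivity)]
    congr 1
    push_cast
    ring
  have h3 : HasSum (fun n : ℕ => Real.exp (-r) * ((r * q : ℝ) ^ n / (n.factorial)))
      (Real.exp (-r) * Real.exp (r * q)) := by
    refine HasSum.mul_left _ ?_
    rw [Real.exp_eq_exp_ℝ]
    exact NormedSpace.expSeries_div_hasSum_exp (r * q : ℝ)
  rw [tsum_congr h2, ← ENNReal.ofReal_tsum_of_nonneg (fun n => by positivity) h3.summable,
    h3.tsum_eq, ← Real.exp_add]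
  congr 2
  push_cast [hq1]
  ring

theorem lintegral_expNeg_mul_poissonMeasure (r : ℝ≥0) (a : ℝ≥0∞) :
    ∫⁻ n : ℕ, expNeg (a * n) ∂poissonMeasure r = expNeg (r * (1 - expNeg a)) := by
  simp_rw [mul_comm a, expNeg_nat_mul]
  exact lintegral_poissonMeasure_pow r (expNeg_le_one a)

/-- The coordinate functions `y ↦ exp (-yᵢ)` on `[0, ∞]^ι`. -/
noncomputable def expNegCoord {ι : Type*} (i : ι) :
    BoundedContinuousFunction (ι → ℝ≥0∞) ℝ :=
  BoundedContinuousFunction.mkOfCompact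
    ⟨fun y => (expNeg (y i)).toReal, by
      exact ENNReal.continuousOn_toReal.comp_continuous
        (continuous_expNeg.comp (continuous_apply i)) fun y => expNeg_ne_top _⟩

/-- Stone–Weierstrass: the functions `exp (-yᵢ)` separate the points of the cube, the value `∞`
included, and their monomials are exactly the test functions. Integer exponents therefore suffice.
-/
theorem ext_of_lintegral_expNeg_sum {ι : Type*} [Fintype ι] {μ ν : Measure (ι → ℝ≥0∞)}
    [IsFiniteMeasure μ] [IsFiniteMeasure ν]
    (h : ∀ n : ι → ℕ, ∫⁻ y, expNeg (∑ i, n i * y i) ∂μ = ∫⁻ y, expNeg (∑ i, n i * y i) ∂ν) :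
    μ = ν := by
  classical
  let S : Set (BoundedContinuousFunction (ι → ℝ≥0∞) ℝ) := Set.range expNegCoord
  let A : StarSubalgebra ℝ (BoundedContinuousFunction (ι → ℝ≥0∞) ℝ) :=
    { Algebra.adjoin ℝ S with
      star_mem' := by
        intro a ha
        have : star a = a := by ext y; simp
        rwa [this] }
  refine ext_of_forall_mem_subalgebra_integral_eq_of_polish (𝕜 := ℝ) (A := A) ?_ ?_
  · intro x y hxy
    obtain ⟨i, hi⟩ := Function.ne_iff.1 hxy
    refine ⟨fun y => (expNeg (y i)).toReal, ⟨(expNegCoord i).toContinuousMapStarₐ ℝ,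
      ⟨expNegCoord i, Algebra.subset_adjoin ⟨i, rfl⟩, rfl⟩, rfl⟩, fun he => hi ?_⟩
    exact expNeg_injective ((ENNReal.toReal_eq_toReal_iff' (expNeg_ne_top _) (expNeg_ne_top _)).1 he)
  · intro g hg
    -- Products of generators are monomials; the exponent `n i` counts the occurrences of coordinate
    -- `i`.
    have hmono : ∀ m ∈ Submonoid.closure S, ∃ n : ι → ℕ, ∀ y, m y =
        (expNeg (∑ i, n i * y i)).toReal := by
      intro m hm
      induction hm using Submonoid.closure_induction with
      | mem x hx =>
        obtain ⟨i, rfl⟩ := hx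
        refine ⟨Pi.single i 1, fun y => ?_⟩
        rw [Finset.sum_eq_single i]
        · simp [expNegCoord]
        · intro j _ hj; simp [hj]
        · simp
      | one => exact ⟨0, fun y => by simp [expNeg_zero]⟩
      | mul x y _ _ hx hy =>
        obtain ⟨n, hn⟩ := hx
        obtain ⟨m, hm⟩ := hy
        refine ⟨n + m, fun z => ?_⟩
        rw [BoundedContinuousFunction.mul_apply, hn, hm, ← ENNReal.toReal_mul, ← expNeg_add,
          ← Finset.sum_add_distrib]
        simp [add_mul]
    have hspan : g ∈ Submodule.span ℝ (Submonoid.closure S : Set _) := by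
      rw [← Algebra.adjoin_eq_span]; exact hg
    have hint : ∀ (g : BoundedContinuousFunction (ι → ℝ≥0∞) ℝ) (ρ : Measure (ι → ℝ≥0∞))
        [IsFiniteMeasure ρ], Integrable (fun x => g x) ρ := fun g ρ _ => g.integrable ρ
    clear hg
    induction hspan using Submodule.span_induction with
    | mem m hm =>
      obtain ⟨n, hn⟩ := hmono m hm
      have hmeas : Measurable fun y : ι → ℝ≥0∞ => expNeg (∑ i, n i * y i) := by fun_prop
      simp_rw [hn]
      rw [integral_toReal hmeas.aemeasurable (ae_of_all _ fun y => (expNeg_ne_top _).lt_top),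
        integral_toReal hmeas.aemeasurable (ae_of_all _ fun y => (expNeg_ne_top _).lt_top), h]
    | zero => simp
    | add f g hf hg ihf ihg =>
      simp only [BoundedContinuousFunction.add_apply]
      rw [integral_add (hint f _) (hint g _), integral_add (hint f _) (hint g _),
        ihf, ihg]
    | smul c f hf ihf =>
      simp only [BoundedContinuousFunction.coe_smul, integral_smul]
      rw [ihf]

/-! ### Laplace functionals determine laws -/

/-- The Laplace functional `f ↦ 𝔼 exp (-∫ f dξ)` of a random measure. -/
noncomputable def laplace {Ω E : Type*} [MeasurableSpace Ω] [MeasurableSpace E] (P : Measure Ω)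
    (ξ : Ω → Measure E) (f : E → ℝ≥0∞) : ℝ≥0∞ :=
  ∫⁻ ω, expNeg (∫⁻ x, f x ∂ξ ω) ∂P

theorem measurable_lintegral_random {Ω E : Type*} [MeasurableSpace Ω] [MeasurableSpace E]
    {ξ : Ω → Measure E} (hξ : Measurable ξ) {f : E → ℝ≥0∞} (hf : Measurable f) :
    Measurable fun ω => ∫⁻ x, f x ∂ξ ω :=
  (Measure.measurable_lintegral hf).comp hξ

theorem measurable_apply_random {Ω E : Type*} [MeasurableSpace Ω] [MeasurableSpace E]
    {ξ : Ω → Measure E} (hξ : Measurable ξ) {B : Set E} (hB : MeasurableSet B) :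
    Measurable fun ω => ξ ω B :=
  (Measure.measurable_coe hB).comp hξ

theorem lintegral_sum_indicator_const {E ι : Type*} [MeasurableSpace E] [Fintype ι]
    (ξ : Measure E) (a : ι → ℝ≥0∞) {B : ι → Set E} (hB : ∀ i, MeasurableSet (B i)) :
    ∫⁻ x, ∑ i, (B i).indicator (fun _ => a i) x ∂ξ = ∑ i, a i * ξ (B i) := by
  rw [lintegral_finsetSum _ fun i _ => measurable_const.indicator (hB i)]
  exact Finset.sum_congr rfl fun i _ => lintegral_indicator_const (hB i) _

/-- The law of a random measure is determined by its Laplace functional. -/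
theorem identDistrib_of_laplace_eq {Ω Ω' E : Type*} [MeasurableSpace Ω] [MeasurableSpace Ω']
    [MeasurableSpace E] {P : Measure Ω} {P' : Measure Ω'} [IsProbabilityMeasure P]
    [IsProbabilityMeasure P'] {ξ : Ω → Measure E} {ξ' : Ω' → Measure E} (hξ : Measurable ξ)
    (hξ' : Measurable ξ')
    (h : ∀ f : E → ℝ≥0∞, Measurable f → laplace P ξ f = laplace P' ξ' f) :
    IdentDistrib ξ ξ' P P' := by
  refine ⟨hξ.aemeasurable, hξ'.aemeasurable, ?_⟩
  let T := {s : Set E // MeasurableSet s}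
  let F : Measure E → (T → ℝ≥0∞) := fun m s => m s.1
  have hF : Measurable F := measurable_pi_lambda _ fun s => Measure.measurable_coe s.2
  -- The `σ`-algebra on measures is generated by the evaluations, so it suffices to identify the law
  -- of the whole family of evaluations.
  have hle : (Measure.instMeasurableSpace : MeasurableSpace (Measure E)) ≤
      MeasurableSpace.comap F MeasurableSpace.pi := by
    refine iSup₂_le fun s hs => ?_
    rintro _ ⟨t, ht, rfl⟩
    exact ⟨(fun y : T → ℝ≥0∞ => y ⟨s, hs⟩) ⁻¹' t, measurable_pi_apply _ ht, rfl⟩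
  have : IsProbabilityMeasure (P.map ξ) := Measure.isProbabilityMeasure_map hξ.aemeasurable
  have : IsProbabilityMeasure (P'.map ξ') := Measure.isProbabilityMeasure_map hξ'.aemeasurable
  have hlaw : (P.map ξ).map F = (P'.map ξ').map F := by
    refine IsProjectiveLimit.unique (P := fun I => ((P'.map ξ').map F).map I.restrict)
      (fun I => ?_) fun I => rfl
    have hm : Measurable (I.restrict (π := fun _ : T => ℝ≥0∞)) := Finset.measurable_restrict I
    have : IsProbabilityMeasure ((P.map ξ).map F) := Measure.isProbabilityMeasure_map hF.aemeasurable
    have : IsProbabilityMeasure ((P'.map ξ').map F) :=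
      Measure.isProbabilityMeasure_map hF.aemeasurable
    refine ext_of_lintegral_expNeg_sum fun n => ?_
    have hB : ∀ i : I, MeasurableSet i.1.1 := fun i => i.1.2
    have hf := h (fun x => ∑ i : I, (i.1.1).indicator (fun _ => (n i : ℝ≥0∞)) x)
      (Finset.measurable_fun_sum _ fun i _ => measurable_const.indicator (hB i))
    simp only [laplace, lintegral_sum_indicator_const _ _ hB] at hf
    have hg : Measurable fun y : I → ℝ≥0∞ => expNeg (∑ i, n i * y i) := by fun_prop
    change ∫⁻ y, _ ∂((P.map ξ).map F).map I.restrict = ∫⁻ y, _ ∂((P'.map ξ').map F).map I.restrict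
    rw [Measure.map_map hm hF, Measure.map_map hm hF, Measure.map_map (hm.comp hF) hξ,
      Measure.map_map (hm.comp hF) hξ', lintegral_map hg ((hm.comp hF).comp hξ),
      lintegral_map hg ((hm.comp hF).comp hξ')]
    exact hf
  refine Measure.ext fun s hs => ?_
  obtain ⟨t, ht, rfl⟩ := hle s hs
  rw [← Measure.map_apply hF ht, ← Measure.map_apply hF ht, hlaw]

/-! ### The Laplace functional of a Poisson process -/

theorem IsPoissonProcess.measurable {Ω E : Type*} [MeasurableSpace Ω] [TopologicalSpace E]
    [MeasurableSpace E] {P : Measure Ω} {ξ : Ω → Measure E} {Λ : Measure E}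
    (hξ : IsPoissonProcess P ξ Λ) : Measurable ξ :=
  hξ.isPointProcess.measurable

theorem IsPoissonProcess.lintegral_expNeg_apply {Ω E : Type*} [MeasurableSpace Ω]
    [TopologicalSpace E] [MeasurableSpace E] {P : Measure Ω} {ξ : Ω → Measure E} {Λ : Measure E}
    (h : IsPoissonProcess P ξ Λ) {B : Set E} (hB : MeasurableSet B) (hfin : Λ B ≠ ∞) (a : ℝ≥0∞) :
    ∫⁻ ω, expNeg (a * ξ ω B) ∂P = expNeg ((1 - expNeg a) * Λ B) := by
  have hm : Measurable fun y : ℝ≥0∞ => expNeg (a * y) := by fun_prop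
  have h1 := lintegral_map (μ := P) hm (measurable_apply_random h.measurable hB)
  rw [← h1, h.law B hB hfin, lintegral_map hm (measurable_of_countable _),
    lintegral_expNeg_mul_poissonMeasure, ENNReal.coe_toNNReal hfin, mul_comm]

theorem lintegral_one_sub_expNeg_simpleFunc {E : Type*} [MeasurableSpace E] (Λ : Measure E)
    (s : SimpleFunc E ℝ≥0∞) :
    ∫⁻ x, (1 - expNeg (s x)) ∂Λ = ∑ y ∈ s.range, (1 - expNeg y) * Λ (s ⁻¹' {y}) := by
  rw [← SimpleFunc.map_lintegral, ← SimpleFunc.lintegral_eq_lintegral]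
  rfl

/-- The level sets of `s` are disjoint, so the counts on them are independent and the expectation
factors into one-dimensional Poisson transforms. -/
theorem IsPoissonProcess.laplace_simpleFunc {Ω E : Type*} [MeasurableSpace Ω]
    [TopologicalSpace E] [MeasurableSpace E] {P : Measure Ω} {ξ : Ω → Measure E} {Λ : Measure E}
    (h : IsPoissonProcess P ξ Λ) (s : SimpleFunc E ℝ≥0∞) (hs : Λ (Function.support s) ≠ ∞) :
    laplace P ξ s = expNeg (∫⁻ x, (1 - expNeg (s x)) ∂Λ) := by
  let e := s.range.equivFin.symm
  let B : Fin s.range.card → Set E := fun i => s ⁻¹' {(e i).1}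
  have hB : ∀ i, MeasurableSet (B i) := fun i => s.measurableSet_preimage _
  have hdisj : Pairwise fun i j => Disjoint (B i) (B j) := by
    intro i j hij
    refine Set.disjoint_left.2 fun x hx hx' => hij (e.injective (Subtype.ext ?_))
    exact (Set.mem_singleton_iff.1 hx).symm.trans (Set.mem_singleton_iff.1 hx')
  have hsum : ∀ g : ℝ≥0∞ → ℝ≥0∞, ∑ y ∈ s.range, g y = ∑ i, g (e i).1 := fun g => by
    rw [← Finset.sum_coe_sort, ← Equiv.sum_comp e]
  have hind := (h.indep _ B hB hdisj).comp (fun i y => expNeg ((e i).1 * y))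
    (fun i => by fun_prop)
  have hprod := lintegral_prod_eq_prod_lintegral_of_indepFun Finset.univ _ hind fun i =>
    (show Measurable fun y => expNeg ((e i).1 * y) by fun_prop).comp
      (measurable_apply_random h.measurable (hB i))
  rw [lintegral_one_sub_expNeg_simpleFunc, hsum, expNeg_sum, laplace]
  have hint : ∀ m : Measure E, ∫⁻ x, s x ∂m = ∑ i, (e i).1 * m (B i) := fun m => by
    rw [SimpleFunc.lintegral_eq_lintegral]
    exact hsum fun y => y * m (s ⁻¹' {y})
  simp_rw [hint, expNeg_sum]
  refine hprod.trans (Finset.prod_congr rfl fun i _ => ?_)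
  -- The level set of the value `0` may have infinite intensity, where the Poisson law is not
  -- available; its factor is `1` on both sides.
  by_cases h0 : (e i).1 = 0
  · have := (h.indep _ B hB hdisj).isProbabilityMeasure
    simp [h0, expNeg_zero]
  · refine h.lintegral_expNeg_apply (hB i) (ne_top_of_le_ne_top hs (measure_mono ?_)) _
    intro x hx
    rw [Function.mem_support, Set.mem_singleton_iff.1 hx]
    exact h0

/-- The usual increasing approximation, cut off to spanning sets of finite measure; at each point
the cut-off eventually has no effect. -/
theorem exists_simpleFunc_approx_of_sigmaFinite {E : Type*} [MeasurableSpace E] (Λ : Measure E)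
    [SigmaFinite Λ] {f : E → ℝ≥0∞} (hf : Measurable f) :
    ∃ s : ℕ → SimpleFunc E ℝ≥0∞, (∀ n, Λ (Function.support (s n)) ≠ ∞) ∧
      (∀ x, Monotone fun n => s n x) ∧
      ∀ x, Filter.Tendsto (fun n => s n x) Filter.atTop (nhds (f x)) := by
  have hS := measurableSet_spanningSets Λ
  refine ⟨fun n => (SimpleFunc.eapprox f n).restrict (spanningSets Λ n), fun n => ?_,
    fun x => ?_, fun x => ?_⟩
  · refine ne_top_of_le_ne_top (measure_spanningSets_lt_top Λ n).ne (measure_mono ?_)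
    rw [SimpleFunc.coe_restrict _ (hS n)]
    exact Set.support_indicator_subset
  · intro m n hmn
    simp only [SimpleFunc.coe_restrict _ (hS _)]
    exact (Set.indicator_le_indicator_of_subset (monotone_spanningSets Λ hmn)
      (fun _ => zero_le) x).trans
        (Set.indicator_le_indicator (SimpleFunc.monotone_eapprox f hmn x))
  · have h1 : Filter.Tendsto (fun n => SimpleFunc.eapprox f n x) Filter.atTop (nhds (f x)) := by
      rw [← SimpleFunc.iSup_eapprox_apply hf x]
      exact tendsto_atTop_iSup fun m n hmn => SimpleFunc.monotone_eapprox f hmn x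
    refine h1.congr' ?_
    filter_upwards [Filter.eventually_ge_atTop (spanningSetsIndex Λ x)] with n hn
    simp only [SimpleFunc.coe_restrict _ (hS _)]
    rw [Set.indicator_of_mem (mem_spanningSets_of_index_le Λ x hn)]

/-- The Laplace functional of a Poisson process. -/
theorem IsPoissonProcess.laplace_eq {Ω E : Type*} [MeasurableSpace Ω]
    [TopologicalSpace E] [MeasurableSpace E] {P : Measure Ω} [IsProbabilityMeasure P]
    {ξ : Ω → Measure E} {Λ : Measure E} [SigmaFinite Λ]
    (h : IsPoissonProcess P ξ Λ) {f : E → ℝ≥0∞} (hf : Measurable f) :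
    laplace P ξ f = expNeg (∫⁻ x, (1 - expNeg (f x)) ∂Λ) := by
  obtain ⟨s, hsfin, hmono, hlim⟩ := exists_simpleFunc_approx_of_sigmaFinite Λ hf
  have hξ := h.measurable
  have h1 : Filter.Tendsto (fun n => laplace P ξ (s n)) Filter.atTop (nhds (laplace P ξ f)) := by
    refine tendsto_lintegral_of_dominated_convergence (fun _ => 1)
      (fun n => (measurable_lintegral_random hξ (s n).measurable).expNeg)
      (fun n => ae_of_all _ fun ω => expNeg_le_one _) (by simp) (ae_of_all _ fun ω => ?_)
    exact (continuous_expNeg.tendsto _).comp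
      (lintegral_tendsto_of_tendsto_of_monotone (fun n => (s n).measurable.aemeasurable)
        (ae_of_all _ hmono) (ae_of_all _ hlim))
  have h2 : Filter.Tendsto (fun n => laplace P ξ (s n)) Filter.atTop
      (nhds (expNeg (∫⁻ x, (1 - expNeg (f x)) ∂Λ))) := by
    simp_rw [fun n => h.laplace_simpleFunc (s n) (hsfin n)]
    refine (continuous_expNeg.tendsto _).comp
      (lintegral_tendsto_of_tendsto_of_monotone
        (fun n => ((s n).measurable.expNeg.const_sub 1).aemeasurable)
        (ae_of_all _ fun x m n hmn => one_sub_expNeg_mono (hmono x hmn)) (ae_of_all _ fun x => ?_))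
    exact (continuous_one_sub_expNeg.tendsto _).comp (hlim x)
  exact tendsto_nhds_unique h1 h2

/-! ### Recognizing a Poisson process by its Laplace functional -/

theorem ext_of_lintegral_expNeg_mul {μ ν : Measure ℝ≥0∞} [IsFiniteMeasure μ] [IsFiniteMeasure ν]
    (h : ∀ n : ℕ, ∫⁻ y, expNeg (n * y) ∂μ = ∫⁻ y, expNeg (n * y) ∂ν) : μ = ν := by
  let g : ℝ≥0∞ → Unit → ℝ≥0∞ := fun y _ => y
  have hg : Measurable g := measurable_pi_lambda _ fun _ => measurable_id
  have key : μ.map g = ν.map g := by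
    refine ext_of_lintegral_expNeg_sum fun n => ?_
    have hm : Measurable fun y : Unit → ℝ≥0∞ => expNeg (∑ i, n i * y i) := by fun_prop
    rw [lintegral_map hm hg, lintegral_map hm hg]
    simpa [g] using h (n ())
  have h2 := congrArg (Measure.map fun y : Unit → ℝ≥0∞ => y ()) key
  rw [Measure.map_map (measurable_pi_apply _) hg, Measure.map_map (measurable_pi_apply _) hg] at h2
  simpa [g, Function.comp_def] using h2

theorem one_sub_expNeg_indicator {E : Type*} (B : Set E) (a : ℝ≥0∞) (x : E) :
    1 - expNeg (B.indicator (fun _ => a) x) = B.indicator (fun _ => 1 - expNeg a) x := by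
  by_cases hx : x ∈ B <;> simp [hx, expNeg_zero]

/-- By disjointness at most one summand is nonzero at `x`. This is what makes the exponent additive
over the sets, and hence the counts independent. -/
theorem one_sub_expNeg_sum_indicator {E ι : Type*} [Fintype ι] {B : ι → Set E}
    (hdisj : Pairwise fun i j => Disjoint (B i) (B j)) (a : ι → ℝ≥0∞) (x : E) :
    1 - expNeg (∑ i, (B i).indicator (fun _ => a i) x) =
      ∑ i, (B i).indicator (fun _ => 1 - expNeg (a i)) x := by
  by_cases hx : ∃ i, x ∈ B i
  · obtain ⟨i, hi⟩ := hx
    have hne : ∀ j, j ≠ i → x ∉ B j := fun j hj hxj => Set.disjoint_left.1 (hdisj hj) hxj hi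
    rw [Finset.sum_eq_single i (fun j _ hj => by simp [hne j hj]) (by simp),
      Finset.sum_eq_single i (fun j _ hj => by simp [hne j hj]) (by simp),
      one_sub_expNeg_indicator]
  · push Not at hx
    simp [hx, expNeg_zero]

section

variable {Ω E : Type*} [MeasurableSpace Ω] [MeasurableSpace E] {P : Measure Ω}
  {ξ : Ω → Measure E} {Λ : Measure E}

theorem lintegral_expNeg_mul_apply_of_laplace
    (h : ∀ f : E → ℝ≥0∞, Measurable f → laplace P ξ f = expNeg (∫⁻ x, (1 - expNeg (f x)) ∂Λ))
    {B : Set E} (hB : MeasurableSet B) (a : ℝ≥0∞) :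
    ∫⁻ ω, expNeg (a * ξ ω B) ∂P = expNeg ((1 - expNeg a) * Λ B) := by
  have h1 := h (B.indicator fun _ => a) (measurable_const.indicator hB)
  simp_rw [one_sub_expNeg_indicator] at h1
  rw [lintegral_indicator_const hB, laplace] at h1
  simpa only [lintegral_indicator_const hB] using h1

variable [IsProbabilityMeasure P]

theorem map_apply_eq_poisson_of_laplace (hξ : Measurable ξ)
    (h : ∀ f : E → ℝ≥0∞, Measurable f → laplace P ξ f = expNeg (∫⁻ x, (1 - expNeg (f x)) ∂Λ))
    {B : Set E} (hB : MeasurableSet B) (hfin : Λ B ≠ ∞) :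
    P.map (fun ω => ξ ω B) = (poissonMeasure (Λ B).toNNReal).map (fun n : ℕ => (n : ℝ≥0∞)) := by
  have hξB := measurable_apply_random hξ hB
  have : IsProbabilityMeasure (P.map fun ω => ξ ω B) :=
    Measure.isProbabilityMeasure_map hξB.aemeasurable
  refine ext_of_lintegral_expNeg_mul fun n => ?_
  have hm : Measurable fun y : ℝ≥0∞ => expNeg (n * y) := by fun_prop
  rw [lintegral_map hm hξB, lintegral_map hm (measurable_of_countable _),
    lintegral_expNeg_mul_poissonMeasure, ENNReal.coe_toNNReal hfin,
    lintegral_expNeg_mul_apply_of_laplace h hB, mul_comm]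

/-- The joint Laplace transform of the counts is the product of the marginal ones, so the joint law
is the product law. -/
theorem iIndepFun_apply_of_laplace (hξ : Measurable ξ)
    (h : ∀ f : E → ℝ≥0∞, Measurable f → laplace P ξ f = expNeg (∫⁻ x, (1 - expNeg (f x)) ∂Λ))
    {ι : Type*} [Fintype ι] {B : ι → Set E} (hB : ∀ i, MeasurableSet (B i))
    (hdisj : Pairwise fun i j => Disjoint (B i) (B j)) :
    iIndepFun (fun i ω => ξ ω (B i)) P := by
  have hξB := fun i => measurable_apply_random hξ (hB i)
  have hξB' : Measurable fun ω i => ξ ω (B i) := measurable_pi_lambda _ hξB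
  have hprob : ∀ i, IsProbabilityMeasure (P.map fun ω => ξ ω (B i)) := fun i =>
    Measure.isProbabilityMeasure_map (hξB i).aemeasurable
  rw [iIndepFun_iff_map_fun_eq_pi_map fun i => (hξB i).aemeasurable]
  have : IsProbabilityMeasure (P.map fun ω i => ξ ω (B i)) :=
    Measure.isProbabilityMeasure_map hξB'.aemeasurable
  refine ext_of_lintegral_expNeg_sum fun n => ?_
  have hm : Measurable fun y : ι → ℝ≥0∞ => expNeg (∑ i, n i * y i) := by fun_prop
  have hm1 : ∀ i, Measurable fun y : ℝ≥0∞ => expNeg (n i * y) := fun i => by fun_prop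
  have h1 := h (fun x => ∑ i, (B i).indicator (fun _ => (n i : ℝ≥0∞)) x)
    (Finset.measurable_fun_sum _ fun i _ => measurable_const.indicator (hB i))
  simp_rw [one_sub_expNeg_sum_indicator hdisj] at h1
  simp only [laplace, lintegral_sum_indicator_const _ _ hB] at h1
  rw [lintegral_map hm hξB', h1, expNeg_sum]
  have hind := iIndepFun_pi (μ := fun i => P.map fun ω => ξ ω (B i))
    (X := fun i (y : ℝ≥0∞) => expNeg (n i * y)) fun i => (hm1 i).aemeasurable
  have h2 := lintegral_prod_eq_prod_lintegral_of_indepFun Finset.univ _ hind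
    fun i => (hm1 i).comp (measurable_pi_apply i)
  simp_rw [expNeg_sum]
  refine Eq.trans (Finset.prod_congr rfl fun i _ => ?_) h2.symm
  rw [← lintegral_expNeg_mul_apply_of_laplace h (hB i), ← lintegral_map (hm1 i) (hξB i),
    ← (measurePreserving_eval (fun i => P.map fun ω => ξ ω (B i)) i).lintegral_comp (hm1 i)]

/-- A point process with the Laplace functional of a Poisson process is a Poisson process. -/
theorem IsPointProcess.isPoissonProcess_of_laplace [TopologicalSpace E] (hpp : IsPointProcess P ξ)
    [hΛ : IsLocallyFiniteMeasure Λ]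
    (h : ∀ f : E → ℝ≥0∞, Measurable f → laplace P ξ f = expNeg (∫⁻ x, (1 - expNeg (f x)) ∂Λ)) :
    IsPoissonProcess P ξ Λ :=
  ⟨hpp, hΛ, fun _ hB hfin => map_apply_eq_poisson_of_laplace hpp.measurable h hB hfin,
    fun _ _ hB hdisj => iIndepFun_apply_of_laplace hpp.measurable h hB hdisj⟩

end

/-! ### Sums of weighted point masses -/

theorem pointSum_apply {Ω E : Type*} [MeasurableSpace E] (X : ℕ → Ω → ℕ) (Y : ℕ → Ω → E) (ω : Ω)
    {A : Set E} (hA : MeasurableSet A) :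
    pointSum X Y ω A = ∑' k, (X k ω : ℝ≥0∞) * A.indicator 1 (Y k ω) := by
  simp [pointSum, Measure.sum_apply _ hA, Measure.dirac_apply' _ hA]

theorem lintegral_pointSum {Ω E : Type*} [MeasurableSpace E] (X : ℕ → Ω → ℕ) (Y : ℕ → Ω → E)
    (ω : Ω) {f : E → ℝ≥0∞} (hf : Measurable f) :
    ∫⁻ x, f x ∂pointSum X Y ω = ∑' k, (X k ω : ℝ≥0∞) * f (Y k ω) := by
  simp [pointSum, lintegral_sum_measure, lintegral_smul_measure, lintegral_dirac' _ hf]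

theorem measurable_pointSum {Ω E : Type*} [MeasurableSpace Ω] [MeasurableSpace E] {X : ℕ → Ω → ℕ}
    {Y : ℕ → Ω → E} (hX : ∀ k, Measurable (X k)) (hY : ∀ k, Measurable (Y k)) :
    Measurable (pointSum X Y) := by
  refine Measure.measurable_of_measurable_coe _ fun A hA => ?_
  simp_rw [pointSum_apply _ _ _ hA]
  refine Measurable.tsum fun k => ?_
  exact ((measurable_of_countable fun n : ℕ => (n : ℝ≥0∞)).comp (hX k)).mul
    ((measurable_one.indicator hA).comp (hY k))

/-- A convergent series of natural numbers has only finitely many nonzero terms. -/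
theorem exists_nat_eq_pointSum_apply {Ω E : Type*} [MeasurableSpace E] (X : ℕ → Ω → ℕ)
    (Y : ℕ → Ω → E) (ω : Ω) {A : Set E} (hA : MeasurableSet A) (hfin : pointSum X Y ω A ≠ ∞) :
    ∃ n : ℕ, pointSum X Y ω A = n := by
  classical
  rw [pointSum_apply _ _ _ hA] at hfin ⊢
  let g : ℕ → ℕ := fun k => if Y k ω ∈ A then X k ω else 0
  have hg : ∀ k, (X k ω : ℝ≥0∞) * A.indicator 1 (Y k ω) = (g k : ℝ≥0∞) := fun k => by
    by_cases hk : Y k ω ∈ A <;> simp [g, hk]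
  simp_rw [hg] at hfin ⊢
  have hs := ENNReal.finite_const_le_of_tsum_ne_top hfin one_ne_zero
  refine ⟨∑ k ∈ hs.toFinset, g k, ?_⟩
  rw [tsum_eq_sum (s := hs.toFinset), Nat.cast_sum]
  intro k hk
  have hk' : g k < 1 := by simpa using hk
  simp [Nat.lt_one_iff.1 hk']

/-- If `∑ₖ Xₖ δ_{Yₖ}` has the Laplace functional of a Poisson process with locally finite
intensity, then it is one. -/
theorem isPoissonProcess_pointSum_of_laplace {Ω E : Type*} [MeasurableSpace Ω] [MeasurableSpace E]
    [TopologicalSpace E] [SigmaCompactSpace E] [WeaklyLocallyCompactSpace E] [T2Space E]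
    [BorelSpace E] {P : Measure Ω} [IsProbabilityMeasure P] {X : ℕ → Ω → ℕ} {Y : ℕ → Ω → E}
    (hX : ∀ k, Measurable (X k)) (hY : ∀ k, Measurable (Y k))
    {Λ : Measure E} [IsLocallyFiniteMeasure Λ]
    (h : ∀ f : E → ℝ≥0∞, Measurable f →
      laplace P (pointSum X Y) f = expNeg (∫⁻ x, (1 - expNeg (f x)) ∂Λ)) :
    IsPoissonProcess P (pointSum X Y) Λ := by
  have hξ := measurable_pointSum hX hY
  refine IsPointProcess.isPoissonProcess_of_laplace ?_ h
  let K : CompactExhaustion E := default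
  have hK : ∀ n, MeasurableSet (K n) := fun n => (K.isCompact n).measurableSet
  have hfin : ∀ᵐ ω ∂P, ∀ n, pointSum X Y ω (K n) ≠ ∞ := by
    refine ae_all_iff.2 fun n => ?_
    -- The count on each compact set of the exhaustion is Poisson, hence almost surely finite; this
    -- gives local finiteness and integer values.
    have hlaw := map_apply_eq_poisson_of_laplace hξ h (hK n) (K.isCompact n).measure_lt_top.ne
    have h1 : ∀ᵐ y ∂P.map (fun ω => pointSum X Y ω (K n)), y ≠ ∞ := by
      rw [hlaw]
      refine (ae_map_iff (measurable_of_countable _).aemeasurable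
        (measurableSet_singleton _).compl).2 ?_
      exact ae_of_all _ fun m => by simp
    exact ae_of_ae_map (measurable_apply_random hξ (hK n)).aemeasurable h1
  refine ⟨hξ, ?_, ?_⟩
  · filter_upwards [hfin] with ω hω
    refine ⟨fun x => ?_⟩
    obtain ⟨n, hn⟩ := K.exists_mem_nhds x
    exact ⟨K n, hn, (hω n).lt_top⟩
  · filter_upwards [hfin] with ω hω A hA hAK
    obtain ⟨L, hL, hAL⟩ := hAK
    obtain ⟨n, hn⟩ := K.exists_superset_of_isCompact hL
    exact exists_nat_eq_pointSum_apply X Y ω hA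
      (ne_top_of_le_ne_top (hω n) (measure_mono (hAL.trans hn)))

/-! ### The intensity `c t⁻¹ dt` in logarithmic coordinates -/

/-- The exponential, as a map from `ℝ` onto `(0, ∞)`. -/
noncomputable def expHalfLine (x : ℝ) : HalfLine := ⟨Real.exp x, Real.exp_pos x⟩

theorem continuous_expHalfLine : Continuous expHalfLine :=
  Real.continuous_exp.subtype_mk _

theorem measurable_expHalfLine : Measurable expHalfLine := continuous_expHalfLine.measurable

/-- Substituting `t = eˣ`, the Jacobian cancels the density `t⁻¹` and leaves `c` times Lebesgue
measure. -/
theorem lintegral_etaIntensity (c : ℝ) {f : HalfLine → ℝ≥0∞} (hf : Measurable f) :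
    ∫⁻ t, f t ∂etaIntensity c = ENNReal.ofReal c * ∫⁻ x, f (expHalfLine x) := by
  have hpos : MeasurableSet {t : ℝ | 0 < t} := measurableSet_Ioi
  have hg : Measurable fun t : HalfLine => ENNReal.ofReal (c * t.1⁻¹) := by fun_prop
  let u : ℝ → ℝ≥0∞ := fun t => if h : 0 < t then ENNReal.ofReal (c * t⁻¹) * f ⟨t, h⟩ else 0
  have hu : ∀ t : HalfLine, ENNReal.ofReal (c * t.1⁻¹) * f t = u t.1 := fun t => by
    simp [u, t.2]
  rw [etaIntensity, lintegral_withDensity_eq_lintegral_mul _ hg hf]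
  simp only [Pi.mul_apply, hu]
  have hemb : MeasurableEmbedding (Subtype.val : HalfLine → ℝ) :=
    MeasurableEmbedding.subtype_coe hpos
  rw [← hemb.lintegral_map, hemb.map_comap, Subtype.range_coe_subtype]
  have himg : {t : ℝ | 0 < t} = Real.exp '' Set.univ := by
    rw [Set.image_univ, Real.range_exp]; rfl
  rw [himg, lintegral_image_eq_lintegral_deriv_mul_of_monotoneOn MeasurableSet.univ
    (fun x _ => (Real.hasDerivAt_exp x).hasDerivWithinAt) (Real.exp_monotone.monotoneOn _),
    Measure.restrict_univ,
    ← lintegral_const_mul _ (show Measurable fun x => f (expHalfLine x) from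
      hf.comp measurable_expHalfLine)]
  refine lintegral_congr fun x => ?_
  have hx : u (Real.exp x) = ENNReal.ofReal (c * (Real.exp x)⁻¹) * f (expHalfLine x) := by
    simp only [u, Real.exp_pos, dif_pos]; rfl
  rw [hx, ← mul_assoc, ← ENNReal.ofReal_mul (Real.exp_pos x).le]
  congr 2
  field_simp

theorem etaIntensity_eq (c : ℝ) :
    etaIntensity c = ENNReal.ofReal c • (volume : Measure ℝ).map expHalfLine := by
  refine Measure.ext_of_lintegral _ fun f hf => ?_
  rw [lintegral_etaIntensity c hf, lintegral_smul_measure, lintegral_map hf measurable_expHalfLine,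
    smul_eq_mul]

/-- The measure `c t⁻¹ dt` is invariant under scaling. -/
theorem lintegral_etaIntensity_mul (c : ℝ) (r : HalfLine) {f : HalfLine → ℝ≥0∞}
    (hf : Measurable f) :
    ∫⁻ t, f ⟨t.1 * r.1, mul_pos t.2 r.2⟩ ∂etaIntensity c = ∫⁻ t, f t ∂etaIntensity c := by
  have hm : Measurable fun t : HalfLine => (⟨t.1 * r.1, mul_pos t.2 r.2⟩ : HalfLine) := by
    fun_prop
  have h := lintegral_etaIntensity c (hf.comp hm)
  simp only [Function.comp_def] at h
  -- Multiplication by `r` becomes translation by `log r`, which preserves Lebesgue measure.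
  rw [h, lintegral_etaIntensity c hf,
    ← lintegral_add_right_eq_self (fun x => f (expHalfLine x)) (Real.log r.1)]
  congr 2
  funext x
  congr 1
  refine Subtype.ext ?_
  simp [expHalfLine, Real.exp_add, Real.exp_log r.2]

/-- The set of points of `(0, ∞)` whose logarithm lies in `[a, b)`. -/
def logIco (a b : ℝ) : Set HalfLine := {t | Real.log t.1 ∈ Set.Ico a b}

theorem measurableSet_logIco (a b : ℝ) : MeasurableSet (logIco a b) :=
  (show Measurable fun t : HalfLine => Real.log t.1 by fun_prop) measurableSet_Ico

theorem etaIntensity_logIco (c : ℝ) (a b : ℝ) :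
    etaIntensity c (logIco a b) = ENNReal.ofReal c * ENNReal.ofReal (b - a) := by
  rw [etaIntensity_eq c, Measure.smul_apply,
    Measure.map_apply measurable_expHalfLine (measurableSet_logIco a b), smul_eq_mul]
  congr 1
  rw [← Real.volume_Ico]
  congr 1
  ext x
  simp [logIco, expHalfLine]

theorem mem_nhds_logIco (t : HalfLine) :
    logIco (Real.log t.1 - 1) (Real.log t.1 + 1) ∈ nhds t := by
  have hc : ContinuousAt (fun t : HalfLine => Real.log t.1) t :=
    (Real.continuousAt_log t.2.ne').comp continuous_subtype_val.continuousAt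
  exact hc (Ico_mem_nhds (by linarith) (by linarith))

instance isLocallyFiniteMeasure_etaIntensity (c : ℝ) :
    IsLocallyFiniteMeasure (etaIntensity c) := by
  refine ⟨fun t => ⟨_, mem_nhds_logIco t, ?_⟩⟩
  rw [etaIntensity_logIco c]
  exact ENNReal.mul_lt_top (by simp) (by simp)

theorem mem_logIco_floor {n : ℕ} (hn : 0 < n) (t : HalfLine) :
    t ∈ logIco (⌊n * Real.log t.1⌋ / n) ((⌊n * Real.log t.1⌋ + 1) / n) := by
  have hn' : (0 : ℝ) < n := by exact_mod_cast hn
  constructor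
  · rw [div_le_iff₀ hn', mul_comm]; exact Int.floor_le _
  · rw [lt_div_iff₀ hn', mul_comm]; exact Int.lt_floor_add_one _

/-! ### Simplicity of the points -/

/-- From `e^{-r} ≥ 1 - r` one gets `1 - e^{-r}(1 + r) ≤ 1 - (1 - r)(1 + r) = r²`. The quadratic
order is what lets the union bound over small cells vanish. -/
theorem poissonMeasure_two_le (r : ℝ≥0) :
    poissonMeasure r {n | 2 ≤ n} ≤ ENNReal.ofReal ((r : ℝ) ^ 2) := by
  have hset : {n : ℕ | 2 ≤ n} = ({0, 1} : Set ℕ)ᶜ := by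
    ext n
    simp only [Set.mem_ofPred_eq, Set.mem_compl_iff, Set.mem_insert_iff, Set.mem_singleton_iff]
    omega
  have h01 : (poissonMeasure r).real {0, 1} = Real.exp (-r) + Real.exp (-r) * r := by
    rw [show ({0, 1} : Set ℕ) = {0} ∪ {1} from rfl,
      measureReal_union (by simp) (measurableSet_singleton _), poissonMeasure_real_singleton,
      poissonMeasure_real_singleton]
    simp
  rw [hset, ← ofReal_measureReal]
  refine ENNReal.ofReal_le_ofReal ?_
  rw [measureReal_compl (Set.to_countable _).measurableSet, h01, probReal_univ]
  have := Real.one_sub_le_exp_neg (r : ℝ)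
  nlinarith [r.2]

theorem IsPoissonProcess.measure_two_le {Ω E : Type*} [MeasurableSpace Ω] [TopologicalSpace E]
    [MeasurableSpace E] {P : Measure Ω} {ξ : Ω → Measure E} {Λ : Measure E}
    (h : IsPoissonProcess P ξ Λ) {B : Set E} (hB : MeasurableSet B) (hfin : Λ B ≠ ∞) :
    P {ω | 2 ≤ ξ ω B} ≤ ENNReal.ofReal ((Λ B).toReal ^ 2) := by
  have h1 : P {ω | 2 ≤ ξ ω B} = P.map (fun ω => ξ ω B) (Set.Ici 2) := by
    rw [Measure.map_apply (measurable_apply_random h.measurable hB)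
      measurableSet_Ici]
    rfl
  rw [h1, h.law B hB hfin, Measure.map_apply (measurable_of_countable _) measurableSet_Ici]
  have h2 : (fun n : ℕ => (n : ℝ≥0∞)) ⁻¹' Set.Ici 2 = {n | 2 ≤ n} := by
    ext n; simp
  rw [h2]
  exact poissonMeasure_two_le _

/-- The points of a Poisson process with intensity `c t⁻¹ dt` are almost surely simple. -/
theorem ae_mult_le_one {Ω : Type*} [MeasurableSpace Ω] {P : Measure Ω} {c : ℝ} (hc : 0 ≤ c)
    {X : ℕ → Ω → ℕ} {Z : ℕ → Ω → HalfLine}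
    (h : IsPoissonProcess P (pointSum X Z) (etaIntensity c)) :
    ∀ᵐ ω ∂P, ∀ k, X k ω ≤ 1 := by
  have hM : ∀ M : ℕ, P {ω | ∃ k, 2 ≤ X k ω ∧ Z k ω ∈ logIco (-M) M} = 0 := by
    intro M
    -- On the logarithmic scale, `[-M, M)` splits into `2Mn` cells of length `1/n` and intensity
    -- `c/n`. A multiple point puts mass at least `2` into its cell, which has probability at most
    -- `(c/n)²`; let `n → ∞` in the sum.
    have hbound : ∀ n : ℕ, 0 < n → P {ω | ∃ k, 2 ≤ X k ω ∧ Z k ω ∈ logIco (-M) M} ≤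
        ENNReal.ofReal (2 * M * c ^ 2 / n) := by
      intro n hn
      have hn' : (0 : ℝ) < n := by exact_mod_cast hn
      let B : ℤ → Set HalfLine := fun i => logIco (i / n) ((i + 1) / n)
      have hB : ∀ i, MeasurableSet (B i) := fun i => measurableSet_logIco _ _
      have hΛ : ∀ i, etaIntensity c (B i) = ENNReal.ofReal (c / n) := fun i => by
        rw [etaIntensity_logIco c, ← ENNReal.ofReal_mul hc]
        congr 1
        field_simp
        ring
      calc P {ω | ∃ k, 2 ≤ X k ω ∧ Z k ω ∈ logIco (-M) M}
          ≤ P (⋃ i ∈ Finset.Ico (-(M * n) : ℤ) (M * n), {ω | 2 ≤ pointSum X Z ω (B i)}) := by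
            refine measure_mono ?_
            rintro ω ⟨k, hk, hZ⟩
            have hmem : Z k ω ∈ B ⌊n * Real.log (Z k ω).1⌋ := mem_logIco_floor hn _
            obtain ⟨h1, h2⟩ := hZ
            simp only [Set.mem_iUnion, Finset.mem_Ico, exists_prop]
            refine ⟨⌊n * Real.log (Z k ω).1⌋, ⟨?_, ?_⟩, ?_⟩
            · rw [Int.le_floor]
              push_cast
              nlinarith
            · rw [Int.floor_lt]
              push_cast
              nlinarith
            · simp only [Set.mem_ofPred_eq]
              rw [pointSum_apply _ _ _ (hB _)]
              refine le_trans ?_ (ENNReal.le_tsum k)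
              rw [Set.indicator_of_mem hmem]
              simpa using hk
        _ ≤ ∑ i ∈ Finset.Ico (-(M * n) : ℤ) (M * n), P {ω | 2 ≤ pointSum X Z ω (B i)} :=
            measure_biUnion_finset_le _ _
        _ ≤ ∑ i ∈ Finset.Ico (-(M * n) : ℤ) (M * n), ENNReal.ofReal ((c / n) ^ 2) := by
            refine Finset.sum_le_sum fun i _ => ?_
            refine (h.measure_two_le (hB i) (by rw [hΛ]; simp)).trans_eq ?_
            rw [hΛ, ENNReal.toReal_ofReal (by positivity)]
        _ = ENNReal.ofReal (2 * M * c ^ 2 / n) := by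
            rw [Finset.sum_const, Int.card_Ico, nsmul_eq_mul, ← ENNReal.ofReal_natCast,
              ← ENNReal.ofReal_mul (by positivity)]
            congr 1
            have : (((M * n - -(M * n) : ℤ).toNat : ℕ) : ℝ) = 2 * M * n := by
              have h3 : (M * n - -(M * n) : ℤ).toNat = 2 * M * n := by
                rw [show (M * n - -(M * n) : ℤ) = ((2 * M * n : ℕ) : ℤ) by push_cast; ring]
                exact Int.toNat_natCast _
              rw [h3]; push_cast; ring
            rw [this]
            field_simp
    have hlim : Filter.Tendsto (fun n : ℕ => ENNReal.ofReal (2 * M * c ^ 2 / n)) Filter.atTop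
        (nhds 0) := by
      rw [← ENNReal.ofReal_zero]
      exact ENNReal.tendsto_ofReal (tendsto_const_div_atTop_nhds_zero_nat _)
    refine le_antisymm (ge_of_tendsto hlim ?_) zero_le
    filter_upwards [Filter.eventually_gt_atTop 0] with n hn using hbound n hn
  have hall : ∀ᵐ ω ∂P, ∀ M : ℕ, ¬ ∃ k, 2 ≤ X k ω ∧ Z k ω ∈ logIco (-M) M :=
    ae_all_iff.2 fun M => by rw [ae_iff]; simpa using hM M
  filter_upwards [hall] with ω hω k
  by_contra hk
  obtain ⟨M, hM⟩ := exists_nat_gt |Real.log (Z k ω).1|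
  exact hω M ⟨k, by omega, (abs_lt.1 hM).1.le, (abs_lt.1 hM).2⟩

/-! ### The Laplace functional of the uplifted process -/

theorem tendsto_laplace_pointSum {Ω E : Type*} [MeasurableSpace Ω] [MeasurableSpace E]
    {P : Measure Ω} [IsFiniteMeasure P] {X : ℕ → Ω → ℕ} {Y : ℕ → Ω → E}
    (hX : ∀ k, Measurable (X k)) (hY : ∀ k, Measurable (Y k)) {f : E → ℝ≥0∞} (hf : Measurable f) :
    Filter.Tendsto (fun n => ∫⁻ ω, ∏ k ∈ Finset.range n, expNeg ((X k ω : ℝ≥0∞) * f (Y k ω)) ∂P)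
      Filter.atTop (nhds (laplace P (pointSum X Y) f)) := by
  refine tendsto_lintegral_of_dominated_convergence (fun _ => 1) (fun n => ?_)
    (fun n => ae_of_all _ fun ω => ?_) (by simp) (ae_of_all _ fun ω => ?_)
  · refine Finset.measurable_fun_prod _ fun k _ => Measurable.expNeg ?_
    exact ((measurable_of_countable fun n : ℕ => (n : ℝ≥0∞)).comp (hX k)).mul (hf.comp (hY k))
  · exact Finset.prod_le_one' fun k _ => expNeg_le_one _
  · simp_rw [← expNeg_sum, lintegral_pointSum X Y ω hf]
    exact (continuous_expNeg.tendsto _).comp (ENNReal.tendsto_nat_tsum _)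

theorem measurable_scaleVec_prod {d : ℕ} :
    Measurable fun p : HalfLine × PuncturedSpace d => scaleVec p.1 p.2 := by
  refine Measurable.subtype_mk ?_
  fun_prop

theorem Measurable.scaleVec {d : ℕ} {α : Type*} [MeasurableSpace α] {Z : α → HalfLine}
    {V : α → PuncturedSpace d} (hZ : Measurable Z) (hV : Measurable V) :
    Measurable fun a => scaleVec (Z a) (V a) :=
  measurable_scaleVec_prod.comp (hZ.prodMk hV)

/-- Fubini: with the sequence `W` frozen, the marks are still i.i.d. with law `Q`, so each factor
can be averaged separately. -/
theorem lintegral_prod_marks {Ω α β : Type*} [MeasurableSpace Ω] [MeasurableSpace α]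
    [MeasurableSpace β] {P : Measure Ω} {W : ℕ → Ω → α} {V : ℕ → Ω → β}
    (hW : ∀ k, Measurable (W k)) (hV : ∀ k, Measurable (V k)) {Q : Measure β}
    (hQ : ∀ k, P.map (V k) = Q) (hiV : iIndepFun V P)
    (hind : IndepFun (fun ω k => W k ω) (fun ω k => V k ω) P) {φ : α → β → ℝ≥0∞}
    (hφ : Measurable (Function.uncurry φ)) (n : ℕ) :
    ∫⁻ ω, ∏ k ∈ Finset.range n, φ (W k ω) (V k ω) ∂P =
      ∫⁻ ω, ∏ k ∈ Finset.range n, ∫⁻ v, φ (W k ω) v ∂Q ∂P := by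
  have := hiV.isProbabilityMeasure
  have hW' : Measurable fun ω k => W k ω := measurable_pi_lambda _ hW
  have hV' : Measurable fun ω k => V k ω := measurable_pi_lambda _ hV
  have hQp : IsProbabilityMeasure Q := by
    rw [← hQ 0]; exact Measure.isProbabilityMeasure_map (hV 0).aemeasurable
  have hΦ : Measurable fun p : (ℕ → α) × (ℕ → β) => ∏ k ∈ Finset.range n, φ (p.1 k) (p.2 k) := by
    refine Finset.measurable_fun_prod _ fun k _ => ?_
    exact hφ.comp (show Measurable fun p : (ℕ → α) × (ℕ → β) => (p.1 k, p.2 k) by fun_prop)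
  have hφ1 : ∀ a, Measurable (φ a) := fun a => hφ.comp measurable_prodMk_left
  have hmap := (indepFun_iff_map_prod_eq_prod_map_map hW'.aemeasurable hV'.aemeasurable).1 hind
  have : IsProbabilityMeasure (P.map fun ω k => V k ω) :=
    Measure.isProbabilityMeasure_map hV'.aemeasurable
  have h1 := lintegral_map (μ := P) hΦ (hW'.prodMk hV')
  have hinner : ∀ w : ℕ → α, ∫⁻ v, ∏ k ∈ Finset.range n, φ (w k) (v k) ∂P.map (fun ω k => V k ω) =
      ∏ k ∈ Finset.range n, ∫⁻ v, φ (w k) v ∂Q := by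
    intro w
    have hm : Measurable fun v : ℕ → β => ∏ k ∈ Finset.range n, φ (w k) (v k) :=
      hΦ.comp measurable_prodMk_left
    rw [lintegral_map hm hV']
    have h2 := lintegral_prod_eq_prod_lintegral_of_indepFun (Finset.range n) _
      (hiV.comp (fun k => φ (w k)) fun k => hφ1 _) fun k => (hφ1 _).comp (hV k)
    refine h2.trans (Finset.prod_congr rfl fun k _ => ?_)
    rw [← hQ k, lintegral_map (hφ1 _) (hV k)]
    rfl
  have hG : Measurable fun a => ∫⁻ v, φ a v ∂Q := hφ.lintegral_prod_right'
  have hGn : Measurable fun w : ℕ → α => ∏ k ∈ Finset.range n, ∫⁻ v, φ (w k) v ∂Q :=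
    Finset.measurable_fun_prod _ fun k _ => hG.comp (measurable_pi_apply k)
  rw [← h1, hmap, lintegral_prod _ hΦ.aemeasurable]
  simp only [hinner]
  rw [lintegral_map hGn hW']

/-- The Laplace functional of the uplifted process. -/
theorem laplace_uplift {Ω : Type*} [MeasurableSpace Ω] {d : ℕ} {P : Measure Ω}
    {c : ℝ} (hc : 0 ≤ c) {X : ℕ → Ω → ℕ} {Z : ℕ → Ω → HalfLine} {V : ℕ → Ω → PuncturedSpace d}
    (hX : ∀ k, Measurable (X k)) (hZ : ∀ k, Measurable (Z k)) (hV : ∀ k, Measurable (V k))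
    (hP : IsPoissonProcess P (pointSum X Z) (etaIntensity c)) {Q : Measure (PuncturedSpace d)}
    (hQ : ∀ k, P.map (V k) = Q) (hiV : iIndepFun V P)
    (hind : IndepFun (fun ω k => (X k ω, Z k ω)) (fun ω k => V k ω) P)
    {f : PuncturedSpace d → ℝ≥0∞} (hf : Measurable f) :
    laplace P (uplift X Z V) f =
      expNeg (∫⁻ z, (1 - ∫⁻ v, expNeg (f (scaleVec z v)) ∂Q) ∂etaIntensity c) := by
  have := hiV.isProbabilityMeasure
  have hQp : IsProbabilityMeasure Q := by
    rw [← hQ 0]; exact Measure.isProbabilityMeasure_map (hV 0).aemeasurable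
  let G : HalfLine → ℝ≥0∞ := fun z => ∫⁻ v, expNeg (f (scaleVec z v)) ∂Q
  have hG : Measurable G :=
    Measurable.lintegral_prod_right' (f := fun p => expNeg (f (_root_.scaleVec p.1 p.2)))
      (hf.comp measurable_scaleVec_prod).expNeg
  have hG1 : ∀ z, G z ≤ 1 := fun z =>
    (lintegral_mono fun v => expNeg_le_one _).trans (by simp)
  -- The test function `-log G`, possibly infinite, is chosen so that its negative exponential is
  -- the mark average `G`.
  have hg : Measurable fun z => negLog (G z) := measurable_negLog.comp hG
  have hfV := tendsto_laplace_pointSum (P := P) hX (fun k => (hZ k).scaleVec (hV k)) hf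
  have hgZ := tendsto_laplace_pointSum (P := P) hX hZ hg
  have hφ : Measurable (Function.uncurry fun (a : ℕ × HalfLine) (v : PuncturedSpace d) =>
      expNeg ((a.1 : ℝ≥0∞) * f (scaleVec a.2 v))) := by
    refine Measurable.expNeg (Measurable.mul ?_ (hf.comp (Measurable.scaleVec ?_ ?_)))
    · exact (measurable_of_countable fun n : ℕ => (n : ℝ≥0∞)).comp
        (measurable_fst.comp measurable_fst)
    · exact measurable_snd.comp measurable_fst
    · exact measurable_snd
  have heq : ∀ n, ∫⁻ ω, ∏ k ∈ Finset.range n,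
        expNeg ((X k ω : ℝ≥0∞) * f (scaleVec (Z k ω) (V k ω))) ∂P =
      ∫⁻ ω, ∏ k ∈ Finset.range n, expNeg ((X k ω : ℝ≥0∞) * negLog (G (Z k ω))) ∂P := by
    intro n
    rw [lintegral_prod_marks (W := fun k ω => (X k ω, Z k ω)) (fun k => (hX k).prodMk (hZ k)) hV hQ
      hiV hind hφ n]
    refine lintegral_congr_ae ?_
    -- Simplicity is essential: all copies of a multiple point would share one mark, and the average
    -- of `e^{-2f}` is in general not the square of the average of `e^{-f}`.
    filter_upwards [ae_mult_le_one hc hP] with ω hω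
    refine Finset.prod_congr rfl fun k _ => ?_
    rcases Nat.le_one_iff_eq_zero_or_eq_one.1 (hω k) with h0 | h1
    · simp [h0, expNeg_zero]
    · simp only [h1, Nat.cast_one, one_mul]
      exact (expNeg_negLog (hG1 _)).symm
  simp_rw [heq] at hfV
  have hlim := tendsto_nhds_unique hfV hgZ
  rw [hP.laplace_eq hg] at hlim
  simp only [expNeg_negLog (hG1 _)] at hlim
  exact hlim

/-! ### Replacing marks by their directions -/

theorem measurable_direction {d : ℕ} : Measurable (direction (d := d)) := by
  refine Measurable.subtype_mk ?_
  fun_prop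

theorem norm_direction {d : ℕ} (x : PuncturedSpace d) : ‖(direction x).1‖ = 1 := by
  have hx : ‖x.1‖ ≠ 0 := norm_ne_zero_iff.2 x.2
  simp [direction, norm_smul, hx]

/-- The measure `c t⁻¹ dt` does not distinguish the rays through `x` and `x / ‖x‖`. -/
theorem lintegral_scaleVec_direction {d : ℕ} (c : ℝ) {h : PuncturedSpace d → ℝ≥0∞}
    (hh : Measurable h) (x : PuncturedSpace d) :
    ∫⁻ z, h (scaleVec z (direction x)) ∂etaIntensity c = ∫⁻ z, h (scaleVec z x) ∂etaIntensity c := by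
  have hx : ‖x.1‖ ≠ 0 := norm_ne_zero_iff.2 x.2
  have hm : Measurable fun z => h (scaleVec z (direction x)) :=
    hh.comp (measurable_id.scaleVec measurable_const)
  -- The scaling factor is `‖x‖`: the substitution `z ↦ z‖x‖` turns the unit vector back into `x`.
  rw [← lintegral_etaIntensity_mul c ⟨‖x.1‖, norm_pos_iff.2 x.2⟩ hm]
  refine lintegral_congr fun z => congrArg h (Subtype.ext ?_)
  simp [scaleVec, direction, smul_smul, hx]

/-- The Laplace functional of the uplifted process, as that of a Poisson process whose intensity
is an integral over the rays through the marks. -/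
theorem laplace_uplift_eq_lintegral_rays {Ω : Type*} [MeasurableSpace Ω] {d : ℕ} {P : Measure Ω}
    {c : ℝ} (hc : 0 ≤ c) {X : ℕ → Ω → ℕ} {Z : ℕ → Ω → HalfLine} {V : ℕ → Ω → PuncturedSpace d}
    (hX : ∀ k, Measurable (X k)) (hZ : ∀ k, Measurable (Z k)) (hV : ∀ k, Measurable (V k))
    (hP : IsPoissonProcess P (pointSum X Z) (etaIntensity c)) {Q : Measure (PuncturedSpace d)}
    (hQ : ∀ k, P.map (V k) = Q) (hiV : iIndepFun V P)
    (hind : IndepFun (fun ω k => (X k ω, Z k ω)) (fun ω k => V k ω) P)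
    {f : PuncturedSpace d → ℝ≥0∞} (hf : Measurable f) :
    laplace P (uplift X Z V) f =
      expNeg (∫⁻ v, ∫⁻ z, (1 - expNeg (f (scaleVec z v))) ∂etaIntensity c ∂Q) := by
  have := hiV.isProbabilityMeasure
  have hQp : IsProbabilityMeasure Q := by
    rw [← hQ 0]; exact Measure.isProbabilityMeasure_map (hV 0).aemeasurable
  have hm : Measurable fun p : HalfLine × PuncturedSpace d => expNeg (f (scaleVec p.1 p.2)) :=
    (hf.comp measurable_scaleVec_prod).expNeg
  rw [laplace_uplift hc hX hZ hV hP hQ hiV hind hf]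
  congr 1
  rw [← lintegral_lintegral_swap (f := fun z v => 1 - expNeg (f (scaleVec z v)))
    (hm.const_sub 1).aemeasurable]
  refine lintegral_congr fun z => ?_
  have hmz : Measurable fun v => expNeg (f (scaleVec z v)) := hm.comp measurable_prodMk_left
  have hfin : ∫⁻ v, expNeg (f (scaleVec z v)) ∂Q ≠ ∞ :=
    ne_top_of_le_ne_top (b := 1) (by simp)
      ((lintegral_mono fun v => expNeg_le_one _).trans (by simp))
  rw [lintegral_sub hmz hfin (ae_of_all _ fun v => expNeg_le_one _)]
  simp

theorem measurable_uplift {Ω : Type*} [MeasurableSpace Ω] {d : ℕ} {X : ℕ → Ω → ℕ}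
    {Z : ℕ → Ω → HalfLine} {V : ℕ → Ω → PuncturedSpace d} (hX : ∀ k, Measurable (X k))
    (hZ : ∀ k, Measurable (Z k)) (hV : ∀ k, Measurable (V k)) : Measurable (uplift X Z V) :=
  measurable_pointSum hX fun k => (hZ k).scaleVec (hV k)

/-- Replacing the marks by their directions does not change the law of the uplifted process. -/
theorem identDistrib_uplift_direction {d : ℕ} {Ω₀ Ω₁ Ω₂ : Type*} [MeasurableSpace Ω₀]
    [MeasurableSpace Ω₁] [MeasurableSpace Ω₂] {P₀ : Measure Ω₀} {P₁ : Measure Ω₁}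
    {P₂ : Measure Ω₂} {c : ℝ} (hc : 0 ≤ c) {V : Ω₀ → PuncturedSpace d} (hV : Measurable V)
    {X₁ : ℕ → Ω₁ → ℕ} {Z₁ : ℕ → Ω₁ → HalfLine} {V' : ℕ → Ω₁ → PuncturedSpace d}
    {X₂ : ℕ → Ω₂ → ℕ} {Z₂ : ℕ → Ω₂ → HalfLine} {U' : ℕ → Ω₂ → PuncturedSpace d}
    (h₁ : IsEtaUplift c P₀ V P₁ X₁ Z₁ V')
    (h₂ : IsEtaUplift c P₀ (fun ω => direction (V ω)) P₂ X₂ Z₂ U') :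
    IdentDistrib (uplift X₁ Z₁ V') (uplift X₂ Z₂ U') P₁ P₂ := by
  have := h₁.iIndep.isProbabilityMeasure
  have := h₂.iIndep.isProbabilityMeasure
  refine identDistrib_of_laplace_eq
    (measurable_uplift h₁.measurable_mult h₁.measurable_point h₁.measurable_vec)
    (measurable_uplift h₂.measurable_mult h₂.measurable_point h₂.measurable_vec) fun f hf => ?_
  have hQ₂ : ∀ k, P₂.map (U' k) = (P₀.map V).map direction := fun k => by
    rw [(h₂.identDistrib k).map_eq, Measure.map_map measurable_direction hV]
    rfl
  rw [laplace_uplift_eq_lintegral_rays hc h₁.measurable_mult h₁.measurable_point h₁.measurable_vec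
      h₁.isPoisson (fun k => (h₁.identDistrib k).map_eq) h₁.iIndep h₁.indep hf,
    laplace_uplift_eq_lintegral_rays hc h₂.measurable_mult h₂.measurable_point h₂.measurable_vec
      h₂.isPoisson hQ₂ h₂.iIndep h₂.indep hf]
  have hm : Measurable fun p : PuncturedSpace d × HalfLine =>
      1 - expNeg (f (scaleVec p.2 p.1)) :=
    (hf.comp (measurable_snd.scaleVec measurable_fst)).expNeg.const_sub 1
  rw [lintegral_map hm.lintegral_prod_right' measurable_direction]
  simp only [lintegral_scaleVec_direction c (h := fun x => 1 - expNeg (f x)) (hf.expNeg.const_sub 1)]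

/-! ### Construction of the process from independent cells -/

theorem iIndepFun_comp_measurePreserving {Ω Ω' ι α : Type*} [MeasurableSpace Ω]
    [MeasurableSpace Ω'] [MeasurableSpace α] {μ : Measure Ω} {μ' : Measure Ω'} {U : ι → Ω → α}
    (hU : ∀ k, Measurable (U k)) (h : iIndepFun U μ) {g : Ω' → Ω} (hg : MeasurePreserving g μ' μ) :
    iIndepFun (fun k ω => U k (g ω)) μ' := by
  have := h.isProbabilityMeasure
  have : IsProbabilityMeasure μ' := ⟨by
    rw [← Set.preimage_univ (f := g), hg.measure_preimage MeasurableSet.univ.nullMeasurableSet,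
      measure_univ]⟩
  have hU' : Measurable fun ω k => U k ω := measurable_pi_lambda _ hU
  have hUg : ∀ k, Measurable fun ω => U k (g ω) := fun k => (hU k).comp hg.measurable
  rw [iIndepFun_iff_map_fun_eq_infinitePi_map hUg]
  have h1 : μ'.map (fun ω k => U k (g ω)) = μ.map fun ω k => U k ω := by
    rw [← hg.map_eq, Measure.map_map hU' hg.measurable]; rfl
  have h2 : ∀ k, μ'.map (fun ω => U k (g ω)) = μ.map (U k) := fun k => by
    rw [← hg.map_eq, Measure.map_map (hU k) hg.measurable]; rfl
  simp_rw [h1, h2]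
  exact h.map_fun_eq_infinitePi_map hU

theorem laplace_comp_measurePreserving {Ω Ω' E : Type*} [MeasurableSpace Ω]
    [MeasurableSpace Ω'] [MeasurableSpace E] {μ : Measure Ω} {μ' : Measure Ω'} {ξ : Ω → Measure E}
    (hξ : Measurable ξ) {g : Ω' → Ω} (hg : MeasurePreserving g μ' μ) {f : E → ℝ≥0∞}
    (hf : Measurable f) : laplace μ' (fun ω => ξ (g ω)) f = laplace μ ξ f :=
  hg.lintegral_comp (measurable_lintegral_random hξ hf).expNeg

/-- The law of a Poisson number of mean `r` together with a sequence of i.i.d. points with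
law `p`. -/
noncomputable def cellLaw {E : Type*} [MeasurableSpace E] (r : ℝ≥0) (p : Measure E)
    [IsProbabilityMeasure p] : Measure (ℕ × (ℕ → E)) :=
  (poissonMeasure r).prod (Measure.infinitePi fun _ => p)

instance {E : Type*} [MeasurableSpace E] (r : ℝ≥0) (p : Measure E) [IsProbabilityMeasure p] :
    IsProbabilityMeasure (cellLaw r p) := by
  unfold cellLaw; infer_instance

theorem measurable_cellSum {E : Type*} [MeasurableSpace E] {f : E → ℝ≥0∞} (hf : Measurable f) :
    Measurable fun y : ℕ × (ℕ → E) => ∑ i ∈ Finset.range y.1, f (y.2 i) :=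
  measurable_from_prod_countable_right fun n =>
    show Measurable fun t : ℕ → E => ∑ i ∈ Finset.range n, f (t i) from
      Finset.measurable_fun_sum _ fun i _ => hf.comp (measurable_pi_apply i)

/-- Given the number `n` of points, the expectation is `(∫ e^{-f} dp)^n`; summing over `n` is the
Poisson generating function at `q = ∫ e^{-f} dp`. -/
theorem lintegral_expNeg_cellSum {E : Type*} [MeasurableSpace E] (r : ℝ≥0) (p : Measure E)
    [IsProbabilityMeasure p] {f : E → ℝ≥0∞} (hf : Measurable f) :
    ∫⁻ y, expNeg (∑ i ∈ Finset.range y.1, f (y.2 i)) ∂cellLaw r p =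
      expNeg (r * ∫⁻ x, (1 - expNeg (f x)) ∂p) := by
  rw [cellLaw, lintegral_prod _ (measurable_cellSum hf).expNeg.aemeasurable]
  have hle : ∫⁻ x, expNeg (f x) ∂p ≤ 1 :=
    (lintegral_mono fun v => expNeg_le_one _).trans (by simp)
  have hinner : ∀ n : ℕ, ∫⁻ t : ℕ → E, expNeg (∑ i ∈ Finset.range n, f (t i))
      ∂Measure.infinitePi (fun _ => p) = (∫⁻ x, expNeg (f x) ∂p) ^ n := by
    intro n
    have hind := iIndepFun_infinitePi (P := fun _ : ℕ => p) (X := fun _ x => expNeg (f x))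
      fun _ => hf.expNeg
    simp_rw [expNeg_sum]
    rw [lintegral_prod_eq_prod_lintegral_of_indepFun _ _ hind
      fun i => hf.expNeg.comp (measurable_pi_apply i)]
    rw [Finset.prod_congr rfl fun i _ =>
      (measurePreserving_eval_infinitePi (fun _ : ℕ => p) i).lintegral_comp hf.expNeg]
    simp
  simp only [hinner]
  rw [lintegral_poissonMeasure_pow r hle, lintegral_sub hf.expNeg
    (ne_top_of_le_ne_top (by simp) hle) (ae_of_all _ fun x => expNeg_le_one _)]
  simp

/-- The multiplicities of a sum of independent cells: the `i`-th point of a cell counts if `i` is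
below the Poisson number of that cell. -/
def cellMult {E : Type*} (k : ℕ) (ω : ℕ → ℕ × (ℕ → E)) : ℕ :=
  if k.unpair.2 < (ω k.unpair.1).1 then 1 else 0

/-- The points of a sum of independent cells. -/
def cellPoint {E : Type*} (k : ℕ) (ω : ℕ → ℕ × (ℕ → E)) : E := (ω k.unpair.1).2 k.unpair.2

theorem measurable_cellMult {E : Type*} [MeasurableSpace E] (k : ℕ) :
    Measurable (cellMult (E := E) k) := by
  refine Measurable.ite ?_ measurable_const measurable_const
  exact measurableSet_lt measurable_const (measurable_fst.comp (measurable_pi_apply _))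

theorem measurable_cellPoint {E : Type*} [MeasurableSpace E] (k : ℕ) :
    Measurable (cellPoint (E := E) k) :=
  (measurable_pi_apply _).comp (measurable_snd.comp (measurable_pi_apply _))

/-- The pairing bijection reindexes `k` as (cell, position in the cell), and the multiplicities
truncate each cell at its Poisson number. -/
theorem lintegral_pointSum_cell {E : Type*} [MeasurableSpace E] (ω : ℕ → ℕ × (ℕ → E))
    {f : E → ℝ≥0∞} (hf : Measurable f) :
    ∫⁻ x, f x ∂pointSum cellMult cellPoint ω =
      ∑' j, ∑ i ∈ Finset.range (ω j).1, f ((ω j).2 i) := by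
  rw [lintegral_pointSum _ _ _ hf, ← Nat.pairEquiv.tsum_eq, ENNReal.tsum_prod']
  refine tsum_congr fun j => ?_
  rw [tsum_eq_sum (s := Finset.range (ω j).1)]
  · refine Finset.sum_congr rfl fun i hi => ?_
    simp [cellMult, cellPoint, Finset.mem_range.1 hi]
  · intro i hi
    have : ¬ i < (ω j).1 := by simpa using hi
    simp [cellMult, this]

theorem laplace_cell {E : Type*} [MeasurableSpace E] (r : ℕ → ℝ≥0) (p : ℕ → Measure E)
    [∀ j, IsProbabilityMeasure (p j)] {f : E → ℝ≥0∞} (hf : Measurable f) :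
    laplace (Measure.infinitePi fun j => cellLaw (r j) (p j)) (pointSum cellMult cellPoint) f =
      expNeg (∑' j, r j * ∫⁻ x, (1 - expNeg (f x)) ∂p j) := by
  have hm := (measurable_cellSum hf).expNeg
  have hind := iIndepFun_infinitePi (P := fun j => cellLaw (r j) (p j))
    (X := fun _ y => expNeg (∑ i ∈ Finset.range y.1, f (y.2 i))) fun _ => hm
  have hfin : ∀ n, ∫⁻ ω, ∏ j ∈ Finset.range n,
      expNeg (∑ i ∈ Finset.range (ω j).1, f ((ω j).2 i))
        ∂Measure.infinitePi (fun j => cellLaw (r j) (p j)) =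
      expNeg (∑ j ∈ Finset.range n, r j * ∫⁻ x, (1 - expNeg (f x)) ∂p j) := by
    intro n
    rw [lintegral_prod_eq_prod_lintegral_of_indepFun _ _ hind
      fun j => hm.comp (measurable_pi_apply j), expNeg_sum]
    refine Finset.prod_congr rfl fun j _ => ?_
    rw [(measurePreserving_eval_infinitePi (fun j => cellLaw (r j) (p j)) j).lintegral_comp hm,
      lintegral_expNeg_cellSum _ _ hf]
  refine tendsto_nhds_unique (f := fun n => ∫⁻ ω, ∏ j ∈ Finset.range n,
      expNeg (∑ i ∈ Finset.range (ω j).1, f ((ω j).2 i))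
        ∂Measure.infinitePi (fun j => cellLaw (r j) (p j))) (l := Filter.atTop) ?_ ?_
  · refine tendsto_lintegral_of_dominated_convergence (fun _ => 1) (fun n => ?_)
      (fun n => ae_of_all _ fun ω => ?_) (by simp) (ae_of_all _ fun ω => ?_)
    · exact Finset.measurable_fun_prod _ fun j _ => hm.comp (measurable_pi_apply j)
    · exact Finset.prod_le_one' fun k _ => expNeg_le_one _
    · simp_rw [← expNeg_sum, lintegral_pointSum_cell ω hf]
      exact (continuous_expNeg.tendsto _).comp (ENNReal.tendsto_nat_tsum _)
  · simp_rw [hfin]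
    exact (continuous_expNeg.tendsto _).comp (ENNReal.tendsto_nat_tsum _)

/-- The probability measure on `[eʲ, eʲ⁺¹)` with density proportional to `t⁻¹`. -/
noncomputable def logUniform (j : ℤ) : Measure HalfLine :=
  ((volume : Measure ℝ).restrict (Set.Ico j (j + 1))).map expHalfLine

instance (j : ℤ) : IsProbabilityMeasure (logUniform j) := by
  have : IsProbabilityMeasure ((volume : Measure ℝ).restrict (Set.Ico (j : ℝ) (j + 1))) :=
    ⟨by simp⟩
  exact Measure.isProbabilityMeasure_map measurable_expHalfLine.aemeasurable

/-- On the logarithmic scale the unit intervals `[j, j + 1)` tile the line, each of intensity `c`;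
this matches the exponent in `laplace_cell`. -/
theorem lintegral_etaIntensity_eq_tsum (c : ℝ) {f : HalfLine → ℝ≥0∞} (hf : Measurable f) :
    ∫⁻ t, f t ∂etaIntensity c =
      ∑' j : ℕ, (c.toNNReal : ℝ≥0∞) * ∫⁻ t, f t ∂logUniform (Equiv.intEquivNat.symm j) := by
  rw [Equiv.tsum_eq Equiv.intEquivNat.symm
    fun j => (c.toNNReal : ℝ≥0∞) * ∫⁻ t, f t ∂logUniform j, ENNReal.tsum_mul_left,
    lintegral_etaIntensity c hf, ← setLIntegral_univ, ← iUnion_Ico_intCast ℝ,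
    lintegral_iUnion (fun _ => measurableSet_Ico) (Set.pairwise_disjoint_Ico_intCast ℝ)]
  simp_rw [logUniform, lintegral_map hf measurable_expHalfLine]
  rfl

/-- A Poisson process on `(0, ∞)` with intensity `c t⁻¹ dt` exists, with an enumeration of its
points. -/
theorem isPoissonProcess_cell (c : ℝ) :
    IsPoissonProcess
      (Measure.infinitePi fun j : ℕ => cellLaw c.toNNReal (logUniform (Equiv.intEquivNat.symm j)))
      (pointSum cellMult cellPoint) (etaIntensity c) := by
  have : LocallyCompactSpace HalfLine := isOpen_Ioi.locallyCompactSpace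
  refine isPoissonProcess_pointSum_of_laplace measurable_cellMult measurable_cellPoint
    fun f hf => ?_
  rw [laplace_cell _ _ hf, lintegral_etaIntensity_eq_tsum c (hf.expNeg.const_sub 1)]

/-- The uplifted process exists for every law of unit vectors. -/
theorem exists_isEtaUplift {d : ℕ} (c : ℝ) (ρ : Measure (PuncturedSpace d))
    [IsProbabilityMeasure ρ] :
    ∃ (Ω' : Type) (_ : MeasurableSpace Ω') (P' : Measure Ω')
      (U : Ω' → PuncturedSpace d) (X : ℕ → Ω' → ℕ) (Z : ℕ → Ω' → HalfLine)
      (U' : ℕ → Ω' → PuncturedSpace d), IsProbabilityMeasure P' ∧ (∀ ω, ‖(U ω).1‖ = 1) ∧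
      IsEtaUplift c P' U P' X Z U' ∧ P'.map U = ρ.map direction := by
  let P₁ := Measure.infinitePi fun j : ℕ =>
    cellLaw c.toNNReal (logUniform (Equiv.intEquivNat.symm j))
  let P₂ := Measure.infinitePi fun _ : ℕ => ρ
  let U' : ℕ → (ℕ → ℕ × (ℕ → HalfLine)) × (ℕ → PuncturedSpace d) → PuncturedSpace d :=
    fun k ω => direction (ω.2 k)
  have hU'0 : ∀ k, Measurable fun y : ℕ → PuncturedSpace d => direction (y k) := fun k =>
    measurable_direction.comp (measurable_pi_apply k)
  have hU' : ∀ k, Measurable (U' k) := fun k => (hU'0 k).comp measurable_snd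
  have hlaw : ∀ k, (P₁.prod P₂).map (U' k) = ρ.map direction := fun k => by
    have h1 : MeasurePreserving (fun ω : (ℕ → ℕ × (ℕ → HalfLine)) × (ℕ → PuncturedSpace d) =>
        ω.2 k) (P₁.prod P₂) ρ :=
      (measurePreserving_eval_infinitePi (fun _ : ℕ => ρ) k).comp measurePreserving_snd
    rw [← h1.map_eq, Measure.map_map measurable_direction h1.measurable]
    rfl
  have hfst : MeasurePreserving Prod.fst (P₁.prod P₂) P₁ := measurePreserving_fst
  have hX : ∀ k, Measurable fun ω : (ℕ → ℕ × (ℕ → HalfLine)) × (ℕ → PuncturedSpace d) =>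
      cellMult k ω.1 := fun k => (measurable_cellMult k).comp measurable_fst
  have hZ : ∀ k, Measurable fun ω : (ℕ → ℕ × (ℕ → HalfLine)) × (ℕ → PuncturedSpace d) =>
      cellPoint k ω.1 := fun k => (measurable_cellPoint k).comp measurable_fst
  -- Only the law of the reference vector matters, so the first mark serves as `U`.
  refine ⟨_, _, P₁.prod P₂, U' 0, fun k ω => cellMult k ω.1, fun k ω => cellPoint k ω.1, U',
    inferInstance, fun ω => norm_direction _, ⟨hX, hZ, hU', ?_, fun k =>
      ⟨(hU' k).aemeasurable, (hU' 0).aemeasurable, (hlaw k).trans (hlaw 0).symm⟩, ?_, ?_⟩, hlaw 0⟩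
  · have : LocallyCompactSpace HalfLine := isOpen_Ioi.locallyCompactSpace
    refine isPoissonProcess_pointSum_of_laplace hX hZ fun f hf => ?_
    exact (laplace_comp_measurePreserving (measurable_pointSum measurable_cellMult
      measurable_cellPoint) hfst hf).trans ((isPoissonProcess_cell c).laplace_eq hf)
  · exact iIndepFun_comp_measurePreserving hU'0
      (iIndepFun_infinitePi (P := fun _ : ℕ => ρ) (X := fun _ => direction)
        fun _ => measurable_direction) measurePreserving_snd
  · have hY : Measurable fun (y : ℕ → PuncturedSpace d) k => direction (y k) :=
      measurable_pi_lambda _ hU'0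
    have hXZ : Measurable fun (y : ℕ → ℕ × (ℕ → HalfLine)) k => (cellMult k y, cellPoint k y) :=
      measurable_pi_lambda _ fun k => (measurable_cellMult k).prodMk (measurable_cellPoint k)
    exact indepFun_prod (μ := P₁) (ν := P₂) hXZ hY

/-! ### Scale-invariant intensities and polar decomposition -/

theorem measurable_scaleVec {d : ℕ} (t : HalfLine) : Measurable (scaleVec (d := d) t) :=
  measurable_const.scaleVec measurable_id

/-- The intensity of a scale-invariant Poisson process is scale-invariant. -/
theorem IsScaleInvariant.map_intensity_eq {Ω : Type*} [MeasurableSpace Ω] {d : ℕ} {P : Measure Ω}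
    [IsProbabilityMeasure P] {ν : Ω → Measure (PuncturedSpace d)} {Λ : Measure (PuncturedSpace d)}
    (hinv : IsScaleInvariant P ν) (hν : IsPoissonProcess P ν Λ) (t : HalfLine) :
    Λ.map (scaleVec t) = Λ := by
  have := hν.intensity_locallyFinite
  refine Measure.ext fun B hB => ?_
  -- Testing with `e^{-ν(B)}` also covers sets of infinite intensity: the exponent is `(1 - e⁻¹)
  -- Λ(B)`, with a finite nonzero coefficient that can be cancelled in `[0, ∞]`.
  have hm : Measurable fun m : Measure (PuncturedSpace d) => expNeg (1 * m B) :=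
    ((Measure.measurable_coe hB).const_mul 1).expNeg
  have h1 := ((hinv t).comp hm).lintegral_eq
  have hpre : MeasurableSet (scaleVec t ⁻¹' B) := measurable_scaleVec t hB
  simp only [Function.comp_def, scaleMeasure, Measure.map_apply (measurable_scaleVec t) hB] at h1
  rw [lintegral_expNeg_mul_apply_of_laplace (fun f hf => hν.laplace_eq hf) hpre,
    lintegral_expNeg_mul_apply_of_laplace (fun f hf => hν.laplace_eq hf) hB] at h1
  have hlt : expNeg 1 < 1 :=
    (expNeg_strictAnti zero_lt_one).trans_eq expNeg_zero
  rw [Measure.map_apply (measurable_scaleVec t) hB]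
  exact (ENNReal.mul_right_inj (tsub_pos_of_lt hlt).ne'
    (ne_top_of_le_ne_top (by simp) (one_sub_expNeg_le 1))).1 (expNeg_injective h1)

/-- The total mass satisfies `𝔼 e^{-ν(E)} = 1` with an integrand at most `1`, which forces `ν(E) =
0` almost surely. -/
theorem IsPoissonProcess.ae_eq_zero {Ω E : Type*} [MeasurableSpace Ω] [TopologicalSpace E]
    [MeasurableSpace E] {P : Measure Ω} [IsProbabilityMeasure P] {ν : Ω → Measure E}
    (h : IsPoissonProcess P ν 0) : ∀ᵐ ω ∂P, ν ω = 0 := by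
  have h1 := h.lintegral_expNeg_apply MeasurableSet.univ (by simp) 1
  have hm := (measurable_apply_random h.measurable MeasurableSet.univ)
  simp only [one_mul, Measure.coe_zero, Pi.zero_apply, mul_zero, expNeg_zero] at h1
  have h2 : ∫⁻ ω, (1 - expNeg (ν ω Set.univ)) ∂P = 0 := by
    rw [lintegral_sub hm.expNeg (by simp [h1]) (ae_of_all _ fun ω => expNeg_le_one _), h1]
    simp
  filter_upwards [(lintegral_eq_zero_iff (hm.expNeg.const_sub 1)).1 h2] with ω hω
  have h3 : expNeg (ν ω Set.univ) = expNeg 0 :=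
    le_antisymm (by rw [expNeg_zero]; exact expNeg_le_one _)
      (by rw [expNeg_zero]; exact tsub_eq_zero_iff_le.1 hω)
  exact Measure.measure_univ_eq_zero.1 (expNeg_injective h3)

/-- The shell `{x | 1 < ‖x‖ ≤ e}`. -/
def unitShell (d : ℕ) : Set (PuncturedSpace d) := {x | Real.log ‖x.1‖ ∈ Set.Ioc 0 1}

theorem measurable_log_norm {d : ℕ} : Measurable fun x : PuncturedSpace d => Real.log ‖x.1‖ := by
  fun_prop

theorem measurableSet_unitShell (d : ℕ) : MeasurableSet (unitShell d) :=
  measurable_log_norm measurableSet_Ioc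

/-- The closed annulus containing the shell stays away from the origin, so it is compact in the
punctured space too. -/
theorem measure_unitShell_lt_top {d : ℕ} (Λ : Measure (PuncturedSpace d))
    [IsLocallyFiniteMeasure Λ] : Λ (unitShell d) < ∞ := by
  let K : Set (PuncturedSpace d) := {x | ‖x.1‖ ∈ Set.Icc 1 (Real.exp 1)}
  have hK : IsCompact K := by
    rw [Subtype.isCompact_iff]
    have himg : (Subtype.val '' K : Set (EuclideanSpace ℝ (Fin d))) =
        {x | ‖x‖ ∈ Set.Icc 1 (Real.exp 1)} := by
      ext x
      constructor
      · rintro ⟨y, hy, rfl⟩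
        exact hy
      · intro hx
        refine ⟨⟨x, fun h0 => ?_⟩, hx, rfl⟩
        have h1 : (1 : ℝ) ≤ ‖x‖ := hx.1
        rw [h0, norm_zero] at h1
        linarith
    rw [himg]
    refine Metric.isCompact_of_isClosed_isBounded (isClosed_Icc.preimage continuous_norm) ?_
    exact (Metric.isBounded_closedBall (x := 0) (r := Real.exp 1)).subset fun x hx => by
      simpa using hx.2
  refine lt_of_le_of_lt (measure_mono fun x hx => ?_) hK.measure_lt_top
  have hpos : 0 < ‖x.1‖ := norm_pos_iff.2 x.2
  exact ⟨((Real.log_pos_iff hpos.le).1 hx.1).le, (Real.log_le_iff_le_exp hpos).1 hx.2⟩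

/-- The indicator function of the shell `{y | z < ‖y‖ ≤ e z}`. -/
noncomputable def shellIndicator {d : ℕ} (z : HalfLine) (y : PuncturedSpace d) : ℝ≥0∞ :=
  (Set.Ioc (0 : ℝ) 1).indicator 1 (Real.log ‖y.1‖ - Real.log z.1)

theorem measurable_shellIndicator {d : ℕ} :
    Measurable fun p : HalfLine × PuncturedSpace d => shellIndicator p.1 p.2 :=
  (measurable_one.indicator measurableSet_Ioc).comp
    (show Measurable fun p : HalfLine × PuncturedSpace d =>
      Real.log ‖p.2.1‖ - Real.log p.1.1 by fun_prop)

theorem measurable_shellIndicator_right {d : ℕ} (z : HalfLine) :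
    Measurable fun y : PuncturedSpace d => shellIndicator z y :=
  (measurable_one.indicator measurableSet_Ioc).comp (measurable_log_norm.sub_const _)

theorem measurable_shellIndicator_left {d : ℕ} (y : PuncturedSpace d) :
    Measurable fun z : HalfLine => shellIndicator z y :=
  (measurable_one.indicator measurableSet_Ioc).comp
    (show Measurable fun z : HalfLine => Real.log ‖y.1‖ - Real.log z.1 by fun_prop)

theorem shellIndicator_scaleVec {d : ℕ} (z : HalfLine) (x : PuncturedSpace d) :
    shellIndicator z (scaleVec z x) = (unitShell d).indicator 1 x := by
  have hz : ‖z.1 • x.1‖ = z.1 * ‖x.1‖ := by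
    rw [norm_smul, Real.norm_eq_abs, abs_of_pos z.2]
  have hlog : Real.log ‖(scaleVec z x).1‖ - Real.log z.1 = Real.log ‖x.1‖ := by
    rw [scaleVec, hz, Real.log_mul z.2.ne' (norm_ne_zero_iff.2 x.2), add_sub_cancel_left]
  rw [shellIndicator, hlog]
  rfl

/-- The admissible `log z` form an interval of length one; this normalization is the reason for the
ratio `e` between the radii. -/
theorem lintegral_shellIndicator {d : ℕ} (y : PuncturedSpace d) :
    ∫⁻ z, shellIndicator z y ∂etaIntensity 1 = 1 := by
  have hset : ∀ z : HalfLine, shellIndicator z y =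
      (logIco (Real.log ‖y.1‖ - 1) (Real.log ‖y.1‖)).indicator 1 z := fun z => by
    have hiff : Real.log ‖y.1‖ - Real.log z.1 ∈ Set.Ioc (0 : ℝ) 1 ↔
        z ∈ logIco (Real.log ‖y.1‖ - 1) (Real.log ‖y.1‖) :=
      ⟨fun hz => ⟨by linarith [hz.2], by linarith [hz.1]⟩,
        fun hz => ⟨by linarith [hz.2], by linarith [hz.1]⟩⟩
    rw [shellIndicator]
    by_cases hz : z ∈ logIco (Real.log ‖y.1‖ - 1) (Real.log ‖y.1‖)
    · rw [Set.indicator_of_mem hz, Set.indicator_of_mem (hiff.2 hz)]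
      rfl
    · rw [Set.indicator_of_notMem hz, Set.indicator_of_notMem fun h => hz (hiff.1 h)]
  simp_rw [hset]
  rw [lintegral_indicator_one (measurableSet_logIco _ _), etaIntensity_logIco]
  simp

/-- Polar decomposition of a scale-invariant measure. -/
theorem lintegral_unitShell_rays {d : ℕ} {Λ : Measure (PuncturedSpace d)} [SFinite Λ]
    (hΛ : ∀ t, Λ.map (scaleVec t) = Λ) {h : PuncturedSpace d → ℝ≥0∞} (hh : Measurable h) :
    ∫⁻ x in unitShell d, ∫⁻ z, h (scaleVec z x) ∂etaIntensity 1 ∂Λ = ∫⁻ x, h x ∂Λ := by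
  have hφ := measurable_shellIndicator (d := d)
  have hrays : ∀ x, Measurable fun z : HalfLine => h (scaleVec z x) := fun x =>
    hh.comp (measurable_id.scaleVec measurable_const)
  calc ∫⁻ x in unitShell d, ∫⁻ z, h (scaleVec z x) ∂etaIntensity 1 ∂Λ
      = ∫⁻ x, ∫⁻ z, shellIndicator z (scaleVec z x) * h (scaleVec z x) ∂etaIntensity 1 ∂Λ := by
        rw [← lintegral_indicator (measurableSet_unitShell d)]
        refine lintegral_congr fun x => ?_
        simp_rw [shellIndicator_scaleVec]
        rw [lintegral_const_mul _ (hrays x)]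
        by_cases hx : x ∈ unitShell d <;> simp [hx]
    _ = ∫⁻ z, ∫⁻ x, shellIndicator z (scaleVec z x) * h (scaleVec z x) ∂Λ ∂etaIntensity 1 := by
        have hs : Measurable fun p : PuncturedSpace d × HalfLine => scaleVec p.2 p.1 :=
          measurable_snd.scaleVec measurable_fst
        have hs' : Measurable fun p : PuncturedSpace d × HalfLine =>
            shellIndicator p.2 (scaleVec p.2 p.1) * h (scaleVec p.2 p.1) :=
          (hφ.comp (measurable_snd.prodMk hs)).mul (hh.comp hs)
        exact lintegral_lintegral_swap hs'.aemeasurable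
    _ = ∫⁻ z, ∫⁻ x, shellIndicator z x * h x ∂Λ ∂etaIntensity 1 := by
        refine lintegral_congr fun z => ?_
        -- Invariance of `Λ` under dilation by `z` replaces `zx` by `x`, for each fixed `z`.
        rw [← lintegral_map (f := fun x => shellIndicator z x * h x)
          ((measurable_shellIndicator_right z).mul hh) (measurable_scaleVec z), hΛ z]
    _ = ∫⁻ x, ∫⁻ z, shellIndicator z x * h x ∂etaIntensity 1 ∂Λ := by
        have hs : Measurable fun p : HalfLine × PuncturedSpace d =>
            shellIndicator p.1 p.2 * h p.2 :=
          hφ.mul (hh.comp measurable_snd)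
        exact lintegral_lintegral_swap hs.aemeasurable
    _ = ∫⁻ x, h x ∂Λ := by
        refine lintegral_congr fun x => ?_
        rw [lintegral_mul_const _ (measurable_shellIndicator_left x), lintegral_shellIndicator, one_mul]

/-! ### Conclusion -/

/-- A scale-invariant Poisson process that is not almost surely zero is an uplift of the process
with intensity `c t⁻¹ dt` by random unit vectors. -/
theorem IsScaleInvariant.exists_identDistrib_uplift {Ω : Type*} [MeasurableSpace Ω] {d : ℕ}
    {P : Measure Ω} [IsProbabilityMeasure P] {ν : Ω → Measure (PuncturedSpace d)}
    {Λ : Measure (PuncturedSpace d)} (hinv : IsScaleInvariant P ν) (hν : IsPoissonProcess P ν Λ)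
    (hne : ¬ ∀ᵐ ω ∂P, ν ω = 0) :
    ∃ (c : ℝ) (Ω' : Type) (_ : MeasurableSpace Ω') (P' : Measure Ω')
      (U : Ω' → PuncturedSpace d) (X : ℕ → Ω' → ℕ) (Z : ℕ → Ω' → HalfLine)
      (U' : ℕ → Ω' → PuncturedSpace d),
      0 < c ∧ IsProbabilityMeasure P' ∧ (∀ ω, ‖(U ω).1‖ = 1) ∧
      IsEtaUplift c P' U P' X Z U' ∧ IdentDistrib ν (uplift X Z U') P P' := by
  have := hν.intensity_locallyFinite
  have hΛ := hinv.map_intensity_eq hν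
  have htop : Λ (unitShell d) ≠ ∞ := (measure_unitShell_lt_top Λ).ne
  have h0 : Λ (unitShell d) ≠ 0 := by
    intro h0
    -- Applied to the constant `1`, the polar decomposition shows that a null shell forces `Λ = 0`,
    -- so that the process vanishes almost surely.
    have h1 := lintegral_unitShell_rays hΛ (h := fun _ => 1) measurable_const
    rw [setLIntegral_measure_zero _ _ h0, lintegral_one] at h1
    rw [Measure.measure_univ_eq_zero.1 h1.symm] at hν
    exact hne hν.ae_eq_zero
  have hρ : IsProbabilityMeasure (cond Λ (unitShell d)) :=
    cond_isProbabilityMeasure_of_finite h0 htop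
  have hc : 0 < (Λ (unitShell d)).toReal := ENNReal.toReal_pos h0 htop
  obtain ⟨Ω', mΩ', P', U, X, Z, U', hP', hU, hup, hlaw⟩ :=
    exists_isEtaUplift (Λ (unitShell d)).toReal (cond Λ (unitShell d))
  refine ⟨_, Ω', mΩ', P', U, X, Z, U', hc, hP', hU, hup, ?_⟩
  refine identDistrib_of_laplace_eq hν.measurable
    (measurable_uplift hup.measurable_mult hup.measurable_point hup.measurable_vec) fun f hf => ?_
  rw [hν.laplace_eq hf, laplace_uplift_eq_lintegral_rays hc.le hup.measurable_mult
    hup.measurable_point hup.measurable_vec hup.isPoisson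
    (fun k => (hup.identDistrib k).map_eq.trans hlaw) hup.iIndep hup.indep hf]
  have hg : Measurable fun x => 1 - expNeg (f x) := hf.expNeg.const_sub 1
  have hm : ∀ c, Measurable fun v => ∫⁻ z, (1 - expNeg (f (scaleVec z v))) ∂etaIntensity c :=
    fun c => Measurable.lintegral_prod_right'
      (f := fun p : PuncturedSpace d × HalfLine => 1 - expNeg (f (scaleVec p.2 p.1)))
      (hg.comp (measurable_snd.scaleVec measurable_fst))
  have hscale : ∀ v, ∫⁻ z, (1 - expNeg (f (scaleVec z v)))
        ∂etaIntensity (Λ (unitShell d)).toReal =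
      Λ (unitShell d) * ∫⁻ z, (1 - expNeg (f (scaleVec z v))) ∂etaIntensity 1 := fun v => by
    have hz : Measurable fun z => 1 - expNeg (f (scaleVec z v)) :=
      hg.comp (measurable_id.scaleVec measurable_const)
    rw [lintegral_etaIntensity _ hz, lintegral_etaIntensity _ hz, ENNReal.ofReal_toReal htop]
    simp
  rw [lintegral_map (hm _) measurable_direction]
  simp only [lintegral_scaleVec_direction _ hg, hscale]
  -- The factor `c = Λ(shell)` cancels the normalization of the conditioned measure, leaving the
  -- polar decomposition of `Λ`.
  rw [lintegral_const_mul _ (hm 1), ProbabilityTheory.cond, lintegral_smul_measure, smul_eq_mul, ← mul_assoc,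
    ENNReal.mul_inv_cancel h0 htop, one_mul, lintegral_unitShell_rays hΛ hg]

theorem lemma5p1 (d : ℕ) :
    -- a scale-invariant Poisson process that is not a.s. empty is some `η_c^U` in law
    (∀ {Ω : Type*} [MeasurableSpace Ω] (P : Measure Ω) [IsProbabilityMeasure P]
      (ν : Ω → Measure (PuncturedSpace d)) (Λ : Measure (PuncturedSpace d)),
      IsPoissonProcess P ν Λ → IsScaleInvariant P ν → ¬ (∀ᵐ ω ∂P, ν ω = 0) →
      ∃ (c : ℝ) (Ω' : Type) (_ : MeasurableSpace Ω') (P' : Measure Ω')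
        (U : Ω' → PuncturedSpace d) (X : ℕ → Ω' → ℕ) (Z : ℕ → Ω' → HalfLine)
        (U' : ℕ → Ω' → PuncturedSpace d),
        0 < c ∧ IsProbabilityMeasure P' ∧ (∀ ω, ‖(U ω).1‖ = 1) ∧
        IsEtaUplift c P' U P' X Z U' ∧ IdentDistrib ν (uplift X Z U') P P') ∧
    -- `η_c^V` and `η_c^U` with `U = V / ‖V‖` have the same law, however they are realized
    (∀ {Ω₀ Ω₁ Ω₂ : Type*} [MeasurableSpace Ω₀] [MeasurableSpace Ω₁] [MeasurableSpace Ω₂]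
      (P₀ : Measure Ω₀) [IsProbabilityMeasure P₀] (P₁ : Measure Ω₁) [IsProbabilityMeasure P₁]
      (P₂ : Measure Ω₂) [IsProbabilityMeasure P₂]
      (c : ℝ) (V : Ω₀ → PuncturedSpace d)
      (X₁ : ℕ → Ω₁ → ℕ) (Z₁ : ℕ → Ω₁ → HalfLine) (V' : ℕ → Ω₁ → PuncturedSpace d)
      (X₂ : ℕ → Ω₂ → ℕ) (Z₂ : ℕ → Ω₂ → HalfLine) (U' : ℕ → Ω₂ → PuncturedSpace d),
      0 < c → Measurable V →
      IsEtaUplift c P₀ V P₁ X₁ Z₁ V' → IsAdmissible P₁ X₁ Z₁ V' →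
      IsEtaUplift c P₀ (fun ω => direction (V ω)) P₂ X₂ Z₂ U' →
      IdentDistrib (uplift X₁ Z₁ V') (uplift X₂ Z₂ U') P₁ P₂) := by
  refine ⟨fun P _ ν Λ hν hinv hne => hinv.exists_identDistrib_uplift hν hne, ?_⟩
  intro Ω₀ Ω₁ Ω₂ _ _ _ P₀ _ P₁ _ P₂ _ c V X₁ Z₁ V' X₂ Z₂ U' hc hV h₁ _ h₂
  exact identDistrib_uplift_direction hc.le hV h₁ h₂
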